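/- Let $\mathbf{FI}$ be the category whose objects are the natural numbers $n\ge 0$ and whose morphisms $m\to n$ are the injections $[m]\hookrightarrow[n]$, where $[n]=\{1,\dots,n\}$. Let $V$ be an FI-module over $\mathbb{C}$, that is, a functor from $\mathbf{FI}$ to $\mathbb{C}$-vector spaces, $n\mapsto V_n$; each $V_n$ is a representation of $S_n$. The shift is $S_{+1}V=V\circ\Xi_1$, where $\Xi_1:\mathbf{FI}\to\mathbf{FI}$ sends $[n]$ to $[n]\sqcup\{0\}\cong[n+1]$ (the new point $0$ becomes $1$, and $i$ becomes $i+1$) and extends an injection by $0\mapsto 0$. * $V$ is *generated in degree $\le d$* if it is the smallest sub-FI-module of itself that contains some set of elements $v_j\in V_{n_j}$ with all $n_j\le d$; it is *finitely generated in degree $\le d$* if such a finite set exists, and *finitely generated* if some finite set of elements, in any degrees, generates it. * For a partition $\lambda$ and $n\ge|\lambda|+\lambda_1$ let $V(\lambda)_n$ be the irreducible representation of $S_n$ that corresponds to the partition $(n-|\lambda|,\lambda_1,\lambda_2,\dots)$ of $n$. $V$ has *weight $\le M$* if for every $n\ge0$ every irreducible constituent $V(\lambda)_n$ of $V_n$ satisfies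 $|\lambda|\le M$. * For $a\le n$ let $S_{n-a}\subseteq S_n$ be the subgroup that fixes $1,\dots,a$. $V$ has *stability degree $\le N$* if for all $a\ge 0$ and $n\ge N+a$ the map of coinvariants $(V_n)_{S_{n-a}}\to(V_{n+1})_{S_{(n+1)-a}}$ induced by the standard inclusion $[n]\hookrightarrow[n+1]$ is an isomorphism of $S_a$-modules. **Theorem.** For every FI-module $V$ over $\mathbb{C}$ and all natural numbers $d,M,N\ge 0$: 1. If $V$ is finitely generated and generated in degree $\le d$, then $S_{+1}V$ is finitely generated in degree $\le d$. Conversely, if $V_0$ is finite-dimensional and $S_{+1}V$ is finitely generated in degree $\le d$, then $V$ is finitely generated in degree $\le d+1$. 2. If $V$ is generated in degree $\le d$, then so is $S_{+1}V$. Conversely, if $S_{+1}V$ is generated in degree $\le d$, then $V$ is generated in degree $\le d+1$. 3. If $S_{+1}V$ has weight $\le M$, then $V$ has weight $\le M+1$. Conversely, if $V$ has weight $\le M$, then $S_{+1}V$ has weight $\le M$. 4. If $S_{+1}V$ has stability degree $\le N$, then $V$ has stability degree $\le N+1$. Conversely, if $V$ has stability degree $\le N$, then $S_{+1}V$ has stability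 degree $\le N$. -/

import Mathlib

open CategoryTheory

universe u

/-! ### The category FI and FI-modules over `ℂ` -/

/-- The category `FI`: its objects are the natural numbers `n`, standing for `[n] = Fin n`. -/
structure FI where
  /-- The number of elements of the finite set. -/
  card : ℕ

/-- Morphisms of `FI` are the injections. -/
instance : SmallCategory FI where
  Hom m n := Fin m.card ↪ Fin n.card
  id m := Function.Embedding.refl (Fin m.card)
  comp f g := Function.Embedding.trans f g

namespace FI

/-- An injection of finite sets, as a morphism of `FI`. -/
def ofEmb {m n : ℕ} (f : Fin m ↪ Fin n) : FI.mk m ⟶ FI.mk n := f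

/-- For an injection `f : [m] → [n]`, the injection `[m] ⊔ {*} → [n] ⊔ {*}` that fixes `*`.
The new point is put first: it is `0 : Fin (m + 1)`, and `i : Fin m` becomes `i.succ`. -/
def extendEmb {m n : ℕ} (f : Fin m ↪ Fin n) : Fin (m + 1) ↪ Fin (n + 1) where
  toFun := Fin.cases 0 (fun i => (f i).succ)
  inj' := by
    intro i j h
    induction i using Fin.cases with
    | zero =>
      induction j using Fin.cases with
      | zero => rfl
      | succ j => exact absurd h (Fin.succ_ne_zero _).symm
    | succ i =>
      induction j using Fin.cases with
      | zero => exact absurd h (Fin.succ_ne_zero _)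
      | succ j => exact congrArg Fin.succ (f.injective (Fin.succ_injective _ h))

/-- The functor `Ξ₁ : FI ⥤ FI`, `[n] ↦ [n] ⊔ {*}`. -/
def addPoint : FI ⥤ FI where
  obj n := FI.mk (n.card + 1)
  map f := ofEmb (extendEmb f)
  map_id _ := by
    refine Function.Embedding.ext fun i => ?_
    induction i using Fin.cases <;> rfl
  map_comp _ _ := by
    refine Function.Embedding.ext fun i => ?_
    induction i using Fin.cases <;> rfl

end FI

/-- An FI-module over `ℂ`: a functor from `FI` to complex vector spaces. -/
abbrev FIModule : Type (u + 1) := FI ⥤ ModuleCat.{u} ℂ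

namespace FIModule

variable (V : FIModule.{u})

/-- The vector space `V_n`. -/
abbrev at' (n : ℕ) : Type u := V.obj (FI.mk n)

/-- The linear map `V_m → V_n` induced by an injection `[m] → [n]`. -/
def mapEmb {m n : ℕ} (f : Fin m ↪ Fin n) : V.at' m →ₗ[ℂ] V.at' n :=
  (V.map (FI.ofEmb f)).hom

/-- The shift `S₊₁ V = V ∘ Ξ₁`. -/
def shift : FIModule.{u} := FI.addPoint ⋙ V

theorem mapEmb_refl (n : ℕ) : V.mapEmb (Function.Embedding.refl (Fin n)) = LinearMap.id :=
  congrArg ModuleCat.Hom.hom (V.map_id (FI.mk n))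

theorem mapEmb_trans {l m n : ℕ} (f : Fin l ↪ Fin m) (g : Fin m ↪ Fin n) :
    V.mapEmb (f.trans g) = V.mapEmb g ∘ₗ V.mapEmb f :=
  congrArg ModuleCat.Hom.hom (V.map_comp (FI.ofEmb f) (FI.ofEmb g))

/-! ### Generation -/

/-- A sub-FI-module of `V`. -/
structure SubFIModule where
  /-- The subspace of `V_n`. -/
  carrier : ∀ n : ℕ, Submodule ℂ (V.at' n)
  map_mem : ∀ {m n : ℕ} (f : Fin m ↪ Fin n) {v : V.at' m},
    v ∈ carrier m → V.mapEmb f v ∈ carrier n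

/-- The set `S` of elements of `⨆ V_n` generates `V`: the only sub-FI-module of `V` that
contains `S` is `V` itself. -/
def Generates (S : Set (Σ n : ℕ, V.at' n)) : Prop :=
  ∀ W : V.SubFIModule, (∀ x ∈ S, x.2 ∈ W.carrier x.1) → ∀ n, W.carrier n = ⊤

/-- `V` is generated in degree `≤ d`. -/
def GeneratedInDegreeLE (d : ℕ) : Prop :=
  ∃ S : Set (Σ n : ℕ, V.at' n), (∀ x ∈ S, x.1 ≤ d) ∧ V.Generates S

/-- `V` is finitely generated. -/
def FinitelyGenerated : Prop :=
  ∃ S : Set (Σ n : ℕ, V.at' n), S.Finite ∧ V.Generates S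

/-- `V` is finitely generated in degree `≤ d`. -/
def FinitelyGeneratedInDegreeLE (d : ℕ) : Prop :=
  ∃ S : Set (Σ n : ℕ, V.at' n), S.Finite ∧ (∀ x ∈ S, x.1 ≤ d) ∧ V.Generates S

/-! ### The representations `V_n` of the symmetric groups -/

/-- The action of `S_n` on `V_n`. -/
def rep (n : ℕ) : Representation ℂ (Equiv.Perm (Fin n)) (V.at' n) where
  toFun σ := V.mapEmb σ.toEmbedding
  map_one' := V.mapEmb_refl n
  map_mul' σ τ := V.mapEmb_trans τ.toEmbedding σ.toEmbedding

end FIModule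

/-! ### Partitions and the irreducible representations of `S_n` -/

/-- The partition `λ[n]`: a first row with `n - |λ|` boxes is put on top of the Young
diagram of `λ`. It is defined for `n ≥ |λ| + λ₁`. -/
def paddedDiagram (lam : YoungDiagram) (n : ℕ) (h : lam.card + lam.rowLen 0 ≤ n) :
    YoungDiagram where
  cells := (Finset.range (n - lam.card)).image (fun j => ((0 : ℕ), j)) ∪
    lam.cells.image (fun c => (c.1 + 1, c.2))
  isLowerSet := by
    rintro ⟨i, j⟩ ⟨i', j'⟩ ⟨hi, hj⟩ hc
    simp only [Finset.coe_union, Finset.coe_image, Finset.coe_range, Set.mem_union,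
      Set.mem_image, Set.mem_Iio, Prod.mk.injEq, Finset.mem_coe, Prod.exists] at hc ⊢
    simp only at hi hj
    rcases hc with ⟨b, hb, h1, h2⟩ | ⟨a, b, hab, h1, h2⟩
    · exact Or.inl ⟨j', by omega, by omega, rfl⟩
    · subst h1 h2
      cases i' with
      | zero =>
        refine Or.inl ⟨j', ?_, rfl, rfl⟩
        have h3 : (0, b) ∈ lam := lam.up_left_mem (Nat.zero_le a) le_rfl hab
        have h4 := YoungDiagram.mem_iff_lt_rowLen.1 h3
        omega
      | succ i' =>
        exact Or.inr ⟨i', j', lam.up_left_mem (by omega) hj hab, rfl, rfl⟩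

section Young

open scoped MonoidAlgebra

variable {n : ℕ} {mu : YoungDiagram}

open scoped Classical in
/-- The Young symmetrizer `c_T = (∑ p) * (∑ sgn(q) q)` of a tableau `T` of shape `mu`
(a numbering of the boxes of `mu`): here `p` runs over the permutations that preserve each row
of `T`, and `q` over those that preserve each column. The box `(i, j)` lies in row `i` and in
column `j`. -/
noncomputable def youngSymmetrizer (T : Fin n ≃ mu.cells) : ℂ[Equiv.Perm (Fin n)] :=
  (∑ p : Equiv.Perm (Fin n) with ∀ k, (T (p k)).1.1 = (T k).1.1,
      MonoidAlgebra.single p (1 : ℂ)) *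
    ∑ q : Equiv.Perm (Fin n) with ∀ k, (T (q k)).1.2 = (T k).1.2,
      MonoidAlgebra.single q ((Equiv.Perm.sign q : ℤ) : ℂ)

/-- The left ideal `ℂ[S_n] c_T`, a subspace of `ℂ[S_n]`. -/
noncomputable def youngIdeal (T : Fin n ≃ mu.cells) : Submodule ℂ ℂ[Equiv.Perm (Fin n)] :=
  LinearMap.range (LinearMap.mulRight ℂ (youngSymmetrizer T))

/-- The irreducible representation `V_mu` of `S_n` that belongs to the partition `mu` of `n`:
the group `S_n` acts on the left ideal `ℂ[S_n] c_T` by left multiplication. Up to isomorphism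
it does not depend on the tableau `T` of shape `mu`. -/
noncomputable def youngRep (T : Fin n ≃ mu.cells) :
    Representation ℂ (Equiv.Perm (Fin n)) (youngIdeal T) where
  toFun g := (LinearMap.mulLeft ℂ (MonoidAlgebra.single g (1 : ℂ))).restrict (by
    rintro _ ⟨y, rfl⟩
    exact ⟨MonoidAlgebra.single g 1 * y, by simp [mul_assoc]⟩)
  map_one' := by
    ext x : 2
    simp [← MonoidAlgebra.one_def]
  map_mul' g h := by
    ext x : 2
    simp [← mul_assoc, MonoidAlgebra.single_mul_single]

end Young

/-- `V_mu` is an irreducible constituent of the representation `ρ` of `S_n`, where `mu` is a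
partition of `n` (`S_n`-representations over `ℂ` are semisimple, so that constituents are
subrepresentations). -/
def IsConstituent {n : ℕ} {E : Type*} [AddCommGroup E] [Module ℂ E]
    (mu : YoungDiagram) (ρ : Representation ℂ (Equiv.Perm (Fin n)) E) : Prop :=
  ∃ (T : Fin n ≃ mu.cells) (f : (youngRep T).IntertwiningMap ρ), Function.Injective f

/-- `V` has weight `≤ d`: for all `n`, every irreducible constituent `V(λ)_n = V_{λ[n]}` of `V_n`
has `|λ| ≤ d`. -/
def FIModule.HasWeightLE (V : FIModule.{u}) (d : ℕ) : Prop :=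
  ∀ (n : ℕ) (lam : YoungDiagram) (h : lam.card + lam.rowLen 0 ≤ n),
    IsConstituent (paddedDiagram lam n h) (V.rep n) → lam.card ≤ d

/-! ### Coinvariants and stability degree -/

/-- The subgroup `S_{n-a}` of `S_n` that fixes each of the first `a` points. -/
def fixFirst (a n : ℕ) : Subgroup (Equiv.Perm (Fin n)) where
  carrier := {σ | ∀ i : Fin n, i.val < a → σ i = i}
  one_mem' _ _ := rfl
  mul_mem' {σ τ} hσ hτ i hi := by rw [Equiv.Perm.mul_apply, hτ i hi, hσ i hi]
  inv_mem' {σ} hσ i hi := by rw [Equiv.Perm.inv_eq_iff_eq, hσ i hi]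

/-- The inclusion `S_a → S_n`, for `a ≤ n`: permutations of the first `a` points. -/
noncomputable def permFirst {a n : ℕ} (h : a ≤ n) :
    Equiv.Perm (Fin a) →* Equiv.Perm (Fin n) :=
  Equiv.Perm.viaEmbeddingHom (Fin.castLEEmb h)

theorem permFirst_castLE {a n : ℕ} (h : a ≤ n) (σ : Equiv.Perm (Fin a)) (i : Fin a) :
    permFirst h σ (Fin.castLE h i) = Fin.castLE h (σ i) :=
  Equiv.Perm.viaEmbedding_apply σ (Fin.castLEEmb h) i

theorem permFirst_of_le {a n : ℕ} (h : a ≤ n) (σ : Equiv.Perm (Fin a)) (i : Fin n)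
    (hi : a ≤ i.val) : permFirst h σ i = i := by
  refine Equiv.Perm.viaEmbedding_apply_of_notMem σ (Fin.castLEEmb h) i ?_
  rintro ⟨j, rfl⟩
  exact absurd j.2 (not_lt.2 hi)

theorem permFirst_commute {a n : ℕ} (h : a ≤ n) (σ : Equiv.Perm (Fin a))
    (τ : fixFirst a n) : permFirst h σ * τ.1 = τ.1 * permFirst h σ := by
  refine (Equiv.Perm.Disjoint.commute fun i => ?_).eq
  rcases lt_or_ge i.val a with hi | hi
  · exact Or.inr (τ.2 i hi)
  · exact Or.inl (permFirst_of_le h σ i hi)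

/-- The permutation of `[n + 1]` that extends a permutation of `[n]` and fixes the last point. -/
noncomputable def permCastSucc {n : ℕ} : Equiv.Perm (Fin n) →* Equiv.Perm (Fin (n + 1)) :=
  Equiv.Perm.viaEmbeddingHom Fin.castSuccEmb

theorem permCastSucc_castSucc {n : ℕ} (σ : Equiv.Perm (Fin n)) (i : Fin n) :
    permCastSucc σ i.castSucc = (σ i).castSucc :=
  Equiv.Perm.viaEmbedding_apply σ Fin.castSuccEmb i

theorem permCastSucc_mem {a n : ℕ} {σ : Equiv.Perm (Fin n)} (hσ : σ ∈ fixFirst a n) :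
    permCastSucc σ ∈ fixFirst a (n + 1) := by
  intro i hi
  induction i using Fin.lastCases with
  | last =>
    refine Equiv.Perm.viaEmbedding_apply_of_notMem σ Fin.castSuccEmb _ ?_
    rintro ⟨j, hj⟩
    exact (Fin.castSucc_lt_last j).ne hj
  | cast i => rw [permCastSucc_castSucc, hσ i hi]

namespace FIModule

variable (V : FIModule.{u})

/-- The representation of `S_{n-a}` on `V_n`. -/
def repFix (a n : ℕ) : Representation ℂ (fixFirst a n) (V.at' n) :=
  (V.rep n).comp (fixFirst a n).subtype

/-- The coinvariant quotient `(V_n)_{S_{n-a}}`. -/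
abbrev Coinv (a n : ℕ) : Type u := (V.repFix a n).Coinvariants

/-- The action of `S_a` on `(V_n)_{S_{n-a}}`, for `a ≤ n`. -/
noncomputable def coinvRep {a n : ℕ} (h : a ≤ n) :
    Representation ℂ (Equiv.Perm (Fin a)) (V.Coinv a n) where
  toFun σ := Representation.Coinvariants.lift (V.repFix a n)
    (Representation.Coinvariants.mk (V.repFix a n) ∘ₗ V.rep n (permFirst h σ)) (by
      intro τ
      ext v
      have h1 : V.rep n (permFirst h σ) (V.repFix a n τ v) =
          V.repFix a n τ (V.rep n (permFirst h σ) v) := by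
        change (V.rep n (permFirst h σ) * V.rep n τ.1) v =
          (V.rep n τ.1 * V.rep n (permFirst h σ)) v
        rw [← map_mul, ← map_mul, permFirst_commute]
      simp only [LinearMap.comp_apply, h1, Representation.Coinvariants.mk_self_apply])
  map_one' := by
    ext v
    simp
  map_mul' σ τ := by
    ext v
    simp

theorem mapEmb_castSucc_rep {n : ℕ} (σ : Equiv.Perm (Fin n)) (τ : Equiv.Perm (Fin (n + 1)))
    (h : ∀ i : Fin n, (σ i).castSucc = τ i.castSucc) (v : V.at' n) :
    V.mapEmb Fin.castSuccEmb (V.rep n σ v) = V.rep (n + 1) τ (V.mapEmb Fin.castSuccEmb v) := by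
  change (V.mapEmb Fin.castSuccEmb ∘ₗ V.mapEmb σ.toEmbedding) v =
    (V.mapEmb τ.toEmbedding ∘ₗ V.mapEmb Fin.castSuccEmb) v
  rw [← mapEmb_trans, ← mapEmb_trans]
  congr 2
  exact Function.Embedding.ext h

/-- The map of `S_a`-modules `(V_n)_{S_{n-a}} → (V_{n+1})_{S_{(n+1)-a}}` that is induced by the
standard inclusion `[n] → [n + 1]`. -/
noncomputable def coinvMap {a n : ℕ} (h : a ≤ n) :
    (V.coinvRep h).IntertwiningMap (V.coinvRep (h.trans n.le_succ)) where
  toLinearMap := Representation.Coinvariants.lift (V.repFix a n)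
    (Representation.Coinvariants.mk (V.repFix a (n + 1)) ∘ₗ V.mapEmb Fin.castSuccEmb) (by
      intro τ
      ext v
      have h1 : V.mapEmb Fin.castSuccEmb (V.repFix a n τ v) =
          V.repFix a (n + 1) ⟨permCastSucc τ.1, permCastSucc_mem τ.2⟩
            (V.mapEmb Fin.castSuccEmb v) :=
        V.mapEmb_castSucc_rep _ _ (fun i => (permCastSucc_castSucc τ.1 i).symm) v
      simp only [LinearMap.comp_apply, h1, Representation.Coinvariants.mk_self_apply])
  isIntertwining' σ := by
    ext v
    refine congrArg (Representation.Coinvariants.mk (V.repFix a (n + 1)))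
      (V.mapEmb_castSucc_rep (permFirst h σ) (permFirst (h.trans n.le_succ) σ) (fun i => ?_) v)
    rcases lt_or_ge i.val a with hi | hi
    · obtain ⟨j, rfl⟩ : ∃ j : Fin a, i = Fin.castLE h j := ⟨⟨i.val, hi⟩, rfl⟩
      have h2 : (Fin.castLE h j).castSucc = Fin.castLE (h.trans n.le_succ) j := rfl
      rw [h2, permFirst_castLE, permFirst_castLE]
      rfl
    · rw [permFirst_of_le h σ i hi, permFirst_of_le _ σ i.castSucc hi]

/-- `V` has stability degree `≤ N`: for all `a` and all `n ≥ N + a`, the induced map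
`(V_n)_{S_{n-a}} → (V_{n+1})_{S_{(n+1)-a}}` is an isomorphism of `S_a`-modules. -/
def HasStabilityDegreeLE (N : ℕ) : Prop :=
  ∀ (a n : ℕ) (h : N + a ≤ n),
    Function.Bijective (V.coinvMap ((Nat.le_add_left a N).trans h))

end FIModule

/-! ### Generation of the shift -/

namespace FIModule

variable {V : FIModule.{u}}

/-! Throughout, `0` is the added point, and `FI.extendEmb` produces exactly the injections that send
`0` to `0`.

Generation. An injection `[k] → [n+1]` that avoids `0` is `Fin.succEmb k` followed by an extended
injection. One that hits `0` is a permutation of the source followed by an extended injection. So a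
generator `v` of degree `k` yields the generators `succ(v)` of degree `k` and, if `k > 0`, the
translates `σ v` of degree `k - 1`. Conversely, generators of the shift, read one degree higher,
generate everything except `V_0`.

Stability. The subgroup of `S_{n+1}` that fixes `0` and the next `a` points is the copy of `S_{n-a}`
acting on the shift. Hence the coinvariant map of the shift at `(a, n)` is that of `V` at `(a+1,
n+1)`, and only `a = 0` remains. Surjectivity there follows by passing to a further quotient.
Injectivity (`coinvMap_zero_injective`) is an averaging argument: the images of an invariant vector
in `V_{n+2}`, modulo the stabilizer of `0`, take only two values, and two linear relations make both
vanish.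

Weight. A bound on the weight is a lower bound `n - M` on the first rows of the constituents of
`V_n`. First rows are detected by symmetrizers of subsets `K` of `[n]`: some constituent has first
row shorter than `k` if and only if some nonzero vector is killed by every symmetrizer with `|K| =
k` (`exists_symKilled_iff`). This criterion compares `V_{n+1}` with the shift directly, because the
shift sees the subsets `K` that avoid `0`; no branching rule is needed. The criterion rests on the
classical theory of Young symmetrizers: `c x c` is a multiple of `c * c`, different shapes
annihilate each other in one order, and there are as many shapes as conjugacy classes, so that no
nonzero vector escapes all of them. -/

theorem mapEmb_mapEmb {l m n : ℕ} (f : Fin l ↪ Fin m) (g : Fin m ↪ Fin n) (v : V.at' l) :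
    V.mapEmb g (V.mapEmb f v) = V.mapEmb (f.trans g) v :=
  (LinearMap.congr_fun (V.mapEmb_trans f g) v).symm

theorem shift_mapEmb {m n : ℕ} (f : Fin m ↪ Fin n) (v : V.at' (m + 1)) :
    V.shift.mapEmb (m := m) (n := n) f v = V.mapEmb (FI.extendEmb f) v :=
  rfl

/-- A sub-FI-module of `V` gives one of the shift. -/
def SubFIModule.shift (W : V.SubFIModule) : V.shift.SubFIModule where
  carrier n := W.carrier (n + 1)
  map_mem f _ hv := W.map_mem (FI.extendEmb f) hv

/-- The elements of `V` all of whose images in the shift lie in a given sub-FI-module. -/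
def SubFIModule.coshift (W : V.shift.SubFIModule) : V.SubFIModule where
  carrier m := ⨅ (n : ℕ) (f : Fin m ↪ Fin (n + 1)),
    Submodule.comap (V.mapEmb f) (W.carrier n : Submodule ℂ (V.at' (n + 1)))
  map_mem {m n} f v hv := by
    simp only [Submodule.mem_iInf] at hv ⊢
    intro k g
    change V.mapEmb g (V.mapEmb f v) ∈ (W.carrier k : Submodule ℂ (V.at' (k + 1)))
    rw [mapEmb_mapEmb]
    exact hv k _

theorem SubFIModule.mem_coshift {W : V.shift.SubFIModule} {m : ℕ} {v : V.at' m} :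
    v ∈ W.coshift.carrier m ↔
      ∀ (n : ℕ) (f : Fin m ↪ Fin (n + 1)), (V.mapEmb f v : V.shift.at' n) ∈ W.carrier n := by
  simp only [SubFIModule.coshift, Submodule.mem_iInf]
  rfl

/-- The elements of the shift that generate the images of an element of `V`. -/
def shiftGens : (Σ n : ℕ, V.at' n) → Set (Σ n : ℕ, V.shift.at' n)
  | ⟨0, v⟩ => {⟨0, (V.mapEmb (Fin.succEmb 0) v : V.at' 1)⟩}
  | ⟨k + 1, v⟩ => {⟨k + 1, (V.mapEmb (Fin.succEmb (k + 1)) v : V.at' (k + 2))⟩} ∪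
      Set.range fun σ : Equiv.Perm (Fin (k + 1)) =>
        ⟨k, (V.mapEmb σ.toEmbedding v : V.at' (k + 1))⟩

theorem shiftGens_finite (x : Σ n : ℕ, V.at' n) : (shiftGens x).Finite := by
  obtain ⟨_ | k, v⟩ := x
  · exact Set.finite_singleton _
  · exact (Set.finite_singleton _).union (Set.finite_range _)

theorem degree_le_of_mem_shiftGens {x : Σ n : ℕ, V.at' n} {y : Σ n : ℕ, V.shift.at' n}
    (h : y ∈ shiftGens x) : y.1 ≤ x.1 := by
  obtain ⟨_ | k, v⟩ := x
  · obtain rfl : y = _ := h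
    exact le_rfl
  · rcases h with h | ⟨σ, rfl⟩
    · obtain rfl : y = _ := h
      exact le_rfl
    · exact Nat.le_succ k

theorem succ_mem_shiftGens (k : ℕ) (v : V.at' k) :
    ⟨k, (V.mapEmb (Fin.succEmb k) v : V.at' (k + 1))⟩ ∈ shiftGens (V := V) ⟨k, v⟩ := by
  cases k with
  | zero => exact rfl
  | succ k => exact Or.inl rfl

/-- An injection that avoids `0` is, up to the shift of the source, an extended one. -/
theorem exists_eq_succ_trans_extendEmb {k n : ℕ} (f : Fin k ↪ Fin (n + 1))
    (h : ∀ i, f i ≠ 0) : ∃ g : Fin k ↪ Fin n, f = (Fin.succEmb k).trans (FI.extendEmb g) := by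
  refine ⟨⟨fun i => (f i).pred (h i), fun i j hij => f.injective (Fin.pred_inj.1 hij)⟩, ?_⟩
  refine Function.Embedding.ext fun i => ?_
  exact (Fin.succ_pred (f i) (h i)).symm

/-- An injection that hits `0` is an extended one, up to a permutation of the source. -/
theorem exists_eq_perm_trans_extendEmb {k n : ℕ} (f : Fin (k + 1) ↪ Fin (n + 1)) {i : Fin (k + 1)}
    (h : f i = 0) : ∃ (σ : Equiv.Perm (Fin (k + 1))) (g : Fin k ↪ Fin n),
      f = σ.toEmbedding.trans (FI.extendEmb g) := by
  have h0 : ∀ j : Fin k, f (Equiv.swap 0 i j.succ) ≠ 0 := by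
    intro j hj
    have h1 := f.injective (hj.trans h.symm)
    rw [← Equiv.swap_apply_left (0 : Fin (k + 1)) i] at h1
    exact Fin.succ_ne_zero j ((Equiv.swap (0 : Fin (k + 1)) i).injective h1)
  refine ⟨Equiv.swap 0 i, ⟨fun j => (f (Equiv.swap 0 i j.succ)).pred (h0 j), fun a b hab => ?_⟩, ?_⟩
  · exact Fin.succ_injective _
      ((Equiv.swap (0 : Fin (k + 1)) i).injective (f.injective (Fin.pred_inj.1 hab)))
  · refine Function.Embedding.ext fun j => ?_
    obtain ⟨j, rfl⟩ := (Equiv.swap (0 : Fin (k + 1)) i).surjective j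
    have h2 : (Equiv.swap (0 : Fin (k + 1)) i) ((Equiv.swap 0 i) j) = j := Equiv.swap_apply_self _ _ _
    change _ = FI.extendEmb _ ((Equiv.swap (0 : Fin (k + 1)) i) ((Equiv.swap 0 i) j))
    rw [h2]
    induction j using Fin.cases with
    | zero => rw [Equiv.swap_apply_left, h]; rfl
    | succ j => exact (Fin.succ_pred _ (h0 j)).symm

/-- The coshift of `W` is a sub-FI-module of `V`, so it suffices that it contains `S`. The two
factorizations of an injection into `[n+1]` reduce this to the elements of `shiftGens`. -/
theorem Generates.shift {S : Set (Σ n : ℕ, V.at' n)} (hS : V.Generates S) :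
    V.shift.Generates (⋃ x ∈ S, shiftGens x) := by
  intro W hW n
  have key : ∀ x ∈ S, x.2 ∈ W.coshift.carrier x.1 := by
    rintro ⟨k, v⟩ hx
    refine SubFIModule.mem_coshift.2 fun n f => ?_
    by_cases h : ∀ i, f i ≠ 0
    · obtain ⟨g, rfl⟩ := exists_eq_succ_trans_extendEmb f h
      rw [← mapEmb_mapEmb, ← shift_mapEmb]
      exact W.map_mem g (hW _ (Set.mem_biUnion hx (succ_mem_shiftGens k v)))
    · push Not at h
      obtain ⟨i, hi⟩ := h
      obtain _ | k := k
      · exact i.elim0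
      obtain ⟨σ, g, rfl⟩ := exists_eq_perm_trans_extendEmb f hi
      rw [← mapEmb_mapEmb, ← shift_mapEmb]
      exact W.map_mem g (hW ⟨k, _⟩ (Set.mem_biUnion hx (Or.inr ⟨σ, rfl⟩)))
  have h1 : ∀ v : V.at' (n + 1), v ∈ (W.carrier n : Submodule ℂ (V.at' (n + 1))) := by
    intro v
    have h2 : v ∈ W.coshift.carrier (n + 1) := by
      rw [hS W.coshift key (n + 1)]
      exact Submodule.mem_top
    -- The identity of `[n+1]` is one of the injections in the definition of the coshift.
    have h3 := SubFIModule.mem_coshift.1 h2 n (Function.Embedding.refl _)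
    rw [mapEmb_refl] at h3
    exact h3
  exact eq_top_iff.2 fun v _ => h1 v

/-- An element of the shift, as an element of `V`. -/
def unshift (x : Σ n : ℕ, V.shift.at' n) : Σ n : ℕ, V.at' n :=
  ⟨x.1 + 1, x.2⟩

/-- A sub-FI-module containing the generators of the shift is everything in all degrees `n + 1`.
Degree `0` is invisible to the shift and has to be spanned separately. -/
theorem Generates.of_shift {S : Set (Σ n : ℕ, V.shift.at' n)} (hS : V.shift.Generates S)
    {B : Set (V.at' 0)} (hB : Submodule.span ℂ B = ⊤) :
    V.Generates (unshift '' S ∪ (fun v => ⟨0, v⟩) '' B) := by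
  intro W hW n
  cases n with
  | zero =>
    rw [eq_top_iff, ← hB, Submodule.span_le]
    exact fun v hv => hW ⟨0, v⟩ (Or.inr ⟨v, hv, rfl⟩)
  | succ n => exact hS W.shift (fun x hx => hW _ (Or.inl ⟨x, hx, rfl⟩)) n

theorem FinitelyGenerated.finitelyGeneratedInDegreeLE {d : ℕ} (h : V.FinitelyGenerated)
    (hd : V.GeneratedInDegreeLE d) : V.FinitelyGeneratedInDegreeLE d := by
  obtain ⟨S, hS, hgen⟩ := h
  obtain ⟨R, hR, hRgen⟩ := hd
  -- The directed union of the submodules generated by finite subsets of `R`. It contains `R`, hence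
  -- is all of `V`, so each of the finitely many elements of `S` needs only finitely many elements
  -- of `R`.
  let U : V.SubFIModule :=
    { carrier := fun n =>
        { carrier := {v | ∃ F : Set (Σ n : ℕ, V.at' n), F.Finite ∧ F ⊆ R ∧
            ∀ W : V.SubFIModule, (∀ x ∈ F, x.2 ∈ W.carrier x.1) → v ∈ W.carrier n}
          zero_mem' := ⟨∅, Set.finite_empty, Set.empty_subset _, fun W _ => zero_mem _⟩
          add_mem' := by
            rintro v w ⟨F, hF, hFR, h1⟩ ⟨G, hG, hGR, h2⟩
            exact ⟨F ∪ G, hF.union hG, Set.union_subset hFR hGR, fun W hW =>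
              add_mem (h1 W fun x hx => hW x (Or.inl hx)) (h2 W fun x hx => hW x (Or.inr hx))⟩
          smul_mem' := by
            rintro c v ⟨F, hF, hFR, h1⟩
            exact ⟨F, hF, hFR, fun W hW => Submodule.smul_mem _ c (h1 W hW)⟩ }
      map_mem := by
        rintro m n f v ⟨F, hF, hFR, h1⟩
        exact ⟨F, hF, hFR, fun W hW => W.map_mem f (h1 W hW)⟩ }
  have hU : ∀ x : Σ n : ℕ, V.at' n, ∃ F : Set (Σ n : ℕ, V.at' n), F.Finite ∧ F ⊆ R ∧
      ∀ W : V.SubFIModule, (∀ x ∈ F, x.2 ∈ W.carrier x.1) → x.2 ∈ W.carrier x.1 := by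
    intro x
    have hx : x.2 ∈ U.carrier x.1 := by
      rw [hRgen U (fun x hx => ⟨{x}, Set.finite_singleton x, Set.singleton_subset_iff.2 hx,
        fun W hW => hW x rfl⟩) x.1]
      exact Submodule.mem_top
    exact hx
  choose F hF hFR hFW using hU
  refine ⟨⋃ x ∈ S, F x, hS.biUnion fun x _ => hF x, fun y hy => ?_, fun W hW => ?_⟩
  · obtain ⟨x, -, hx⟩ := Set.mem_iUnion₂.1 hy
    exact hR y (hFR x hx)
  · exact hgen W fun x hx => hFW x W fun y hy => hW y (Set.mem_biUnion hx hy)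

theorem FinitelyGeneratedInDegreeLE.shift {d : ℕ} (h : V.FinitelyGeneratedInDegreeLE d) :
    V.shift.FinitelyGeneratedInDegreeLE d := by
  obtain ⟨S, hS, hd, hgen⟩ := h
  refine ⟨_, hS.biUnion fun x _ => shiftGens_finite x, fun y hy => ?_, hgen.shift⟩
  obtain ⟨x, hxS, hx⟩ := Set.mem_iUnion₂.1 hy
  exact (degree_le_of_mem_shiftGens hx).trans (hd x hxS)

theorem GeneratedInDegreeLE.shift {d : ℕ} (h : V.GeneratedInDegreeLE d) :
    V.shift.GeneratedInDegreeLE d := by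
  obtain ⟨S, hd, hgen⟩ := h
  refine ⟨_, fun y hy => ?_, hgen.shift⟩
  obtain ⟨x, hxS, hx⟩ := Set.mem_iUnion₂.1 hy
  exact (degree_le_of_mem_shiftGens hx).trans (hd x hxS)

theorem FinitelyGeneratedInDegreeLE.of_shift {d : ℕ} [hV : Module.Finite ℂ (V.at' 0)]
    (h : V.shift.FinitelyGeneratedInDegreeLE d) : V.FinitelyGeneratedInDegreeLE (d + 1) := by
  obtain ⟨S, hS, hd, hgen⟩ := h
  obtain ⟨B, hB⟩ := hV.fg_top
  refine ⟨_, (hS.image _).union (B.finite_toSet.image _), ?_, hgen.of_shift hB⟩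
  rintro _ (⟨x, hx, rfl⟩ | ⟨v, -, rfl⟩)
  · exact Nat.succ_le_succ (hd x hx)
  · exact Nat.zero_le _

theorem GeneratedInDegreeLE.of_shift {d : ℕ} (h : V.shift.GeneratedInDegreeLE d) :
    V.GeneratedInDegreeLE (d + 1) := by
  obtain ⟨S, hd, hgen⟩ := h
  refine ⟨_, ?_, hgen.of_shift (Submodule.span_univ)⟩
  rintro _ (⟨x, hx, rfl⟩ | ⟨v, -, rfl⟩)
  · exact Nat.succ_le_succ (hd x hx)
  · exact Nat.zero_le _

end FIModule

/-! ### Stability degree of the shift -/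

theorem exists_perm_extending {α β : Type*} [Finite β] (f g : α ↪ β) :
    ∃ τ : Equiv.Perm β, ∀ a, τ (f a) = g a := by
  classical
  have := Fintype.ofFinite β
  let e : {x // x ∈ Set.range f} ≃ {x // x ∈ Set.range g} :=
    (Equiv.ofInjective f f.injective).symm.trans (Equiv.ofInjective g g.injective)
  refine ⟨e.extendSubtype, fun a => ?_⟩
  rw [Equiv.extendSubtype_apply_of_mem e (f a) ⟨a, rfl⟩]
  have : (Equiv.ofInjective f f.injective).symm ⟨f a, a, rfl⟩ = a :=
    (Equiv.ofInjective f f.injective).symm_apply_apply a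
  simp only [e, Equiv.trans_apply]
  rw [this]
  rfl

/-- The permutation of `[n] ⊔ {*}` that extends a permutation of `[n]`. -/
noncomputable def extendPerm {n : ℕ} (σ : Equiv.Perm (Fin n)) : Equiv.Perm (Fin (n + 1)) :=
  Equiv.ofBijective (FI.extendEmb σ.toEmbedding)
    (Finite.injective_iff_bijective.1 (FI.extendEmb σ.toEmbedding).injective)

theorem extendPerm_injective (n : ℕ) : Function.Injective (extendPerm (n := n)) := fun _ _ h =>
  Equiv.ext fun i => Fin.succ_injective _ (DFunLike.congr_fun h i.succ)

theorem exists_extendPerm_eq {n : ℕ} {τ : Equiv.Perm (Fin (n + 1))} (h : τ 0 = 0) :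
    ∃ σ, extendPerm σ = τ := by
  obtain ⟨e, he⟩ := FIModule.exists_eq_succ_trans_extendEmb ((Fin.succEmb n).trans τ.toEmbedding)
    fun i hi => Fin.succ_ne_zero i (τ.injective (hi.trans h.symm))
  refine ⟨Equiv.ofBijective e (Finite.injective_iff_bijective.1 e.injective), Equiv.ext fun i => ?_⟩
  induction i using Fin.cases with
  | zero => exact h.symm
  | succ i => exact (DFunLike.congr_fun he i).symm

namespace FIModule

variable {V : FIModule.{u}}

/-! ### Averaging over a finite group and kernels of coinvariants. -/

theorem mem_ker_congr {G H : Type*} [Group G] [Group H] {E : Type*} [AddCommGroup E] [Module ℂ E]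
    {ρ : Representation ℂ G E} {τ : Representation ℂ H E}
    (h : ∀ g, ∃ g', ρ g = τ g') :
    Representation.Coinvariants.ker ρ ≤ Representation.Coinvariants.ker τ := by
  refine Submodule.span_le.2 ?_
  rintro _ ⟨⟨g, v⟩, rfl⟩
  obtain ⟨g', hg⟩ := h g
  simp only [hg]
  exact Representation.Coinvariants.sub_mem_ker g' v

theorem sum_rep_eq_zero {G : Type*} [Group G] [Fintype G] {E : Type*} [AddCommGroup E]
    [Module ℂ E] {ρ : Representation ℂ G E} {v : E} (hv : v ∈ Representation.Coinvariants.ker ρ) :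
    ∑ g, ρ g v = 0 := by
  have h : Representation.Coinvariants.ker ρ ≤ LinearMap.ker (∑ g, ρ g) := by
    refine Submodule.span_le.2 ?_
    rintro _ ⟨⟨g, w⟩, rfl⟩
    simp only [SetLike.mem_coe, LinearMap.mem_ker, map_sub, LinearMap.sum_apply, sub_eq_zero,
      ← Module.End.mul_apply, ← map_mul]
    exact Equiv.sum_comp (Equiv.mulRight g) fun g => ρ g w
  simpa [LinearMap.sum_apply] using h hv

theorem sum_rep_sub_smul_mem_ker {G : Type*} [Group G] [Fintype G] {E : Type*} [AddCommGroup E]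
    [Module ℂ E] (ρ : Representation ℂ G E) (v : E) :
    ∑ g, ρ g v - (Fintype.card G : ℂ) • v ∈ Representation.Coinvariants.ker ρ := by
  have h : (Fintype.card G : ℂ) • v = ∑ _g : G, v := by
    rw [Finset.sum_const, Finset.card_univ, Nat.cast_smul_eq_nsmul]
  rw [h, ← Finset.sum_sub_distrib]
  exact sum_mem fun g _ => Representation.Coinvariants.sub_mem_ker g v

theorem rep_sum_rep {G : Type*} [Group G] [Fintype G] {E : Type*} [AddCommGroup E]
    [Module ℂ E] (ρ : Representation ℂ G E) (g : G) (v : E) :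
    ρ g (∑ h, ρ h v) = ∑ h, ρ h v := by
  simp only [map_sum, ← Module.End.mul_apply, ← map_mul]
  exact Equiv.sum_comp (Equiv.mulLeft g) fun h => ρ h v

variable (V) in
/-- The kernel of the projection `V_n → (V_n)_{S_{n-a}}`. -/
noncomputable abbrev coinvKer (a n : ℕ) : Submodule ℂ (V.at' n) :=
  Representation.Coinvariants.ker (V.repFix a n)

theorem coinvKer_anti {a b n : ℕ} (h : a ≤ b) : V.coinvKer b n ≤ V.coinvKer a n :=
  mem_ker_congr fun g => ⟨⟨g.1, fun i hi => g.2 i (hi.trans_le h)⟩, rfl⟩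

/-- Permutations of `[n+1]` fixing the first `a + 1 ≥ 1` points fix `0`, so they are exactly the
extensions of permutations of `[n]` fixing the first `a`. The same subspace of `V_{n+1}` is divided
out on both sides. -/
theorem coinvKer_shift (a n : ℕ) : V.shift.coinvKer a n = V.coinvKer (a + 1) (n + 1) := by
  refine le_antisymm (Submodule.span_le.2 ?_) (Submodule.span_le.2 ?_)
  · rintro _ ⟨⟨g, (v : V.at' (n + 1))⟩, rfl⟩
    refine Representation.Coinvariants.sub_mem_ker (ρ := V.repFix (a + 1) (n + 1))
      ⟨extendPerm g.1, fun i hi => ?_⟩ v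
    induction i using Fin.cases with
    | zero => rfl
    | succ i => exact congrArg Fin.succ (g.2 i (Nat.lt_of_succ_lt_succ hi))
  · rintro _ ⟨⟨⟨g, hg⟩, v⟩, rfl⟩
    obtain ⟨g, rfl⟩ := exists_extendPerm_eq (hg 0 (Nat.succ_pos a))
    exact Representation.Coinvariants.sub_mem_ker (ρ := V.shift.repFix a n)
      ⟨g, fun i hi => Fin.succ_injective _ (hg i.succ (Nat.succ_lt_succ hi))⟩ v

theorem coinvKer_zero (n : ℕ) : V.coinvKer 0 n = Representation.Coinvariants.ker (V.rep n) :=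
  le_antisymm (mem_ker_congr fun g => ⟨g.1, rfl⟩)
    (mem_ker_congr fun g => ⟨⟨g, fun _ hi => absurd hi (Nat.not_lt_zero _)⟩, rfl⟩)

theorem coinvMap_injective_iff {a n : ℕ} (h : a ≤ n) :
    Function.Injective (V.coinvMap h) ↔
      ∀ v : V.at' n, V.mapEmb Fin.castSuccEmb v ∈ V.coinvKer a (n + 1) → v ∈ V.coinvKer a n := by
  have : Function.Injective (V.coinvMap h) ↔ Function.Injective (V.coinvMap h).toLinearMap := Iff.rfl
  rw [this, injective_iff_map_eq_zero]
  constructor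
  · intro H v hv
    exact (Representation.Coinvariants.mk_eq_zero _).1
      (H _ ((Representation.Coinvariants.mk_eq_zero _).2 hv))
  · intro H x
    induction x using Representation.Coinvariants.induction_on with | h v
    intro hv
    exact (Representation.Coinvariants.mk_eq_zero _).2
      (H v ((Representation.Coinvariants.mk_eq_zero _).1 hv))

theorem coinvMap_surjective_iff {a n : ℕ} (h : a ≤ n) :
    Function.Surjective (V.coinvMap h) ↔
      ∀ w : V.at' (n + 1), ∃ v : V.at' n, V.mapEmb Fin.castSuccEmb v - w ∈ V.coinvKer a (n + 1) := by
  constructor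
  · intro H w
    obtain ⟨x, hx⟩ := H (Representation.Coinvariants.mk _ w)
    induction x using Representation.Coinvariants.induction_on with | h v
    exact ⟨v, (Representation.Coinvariants.mk_eq_iff _).1 hx⟩
  · intro H x
    induction x using Representation.Coinvariants.induction_on with | h w
    obtain ⟨v, hv⟩ := H w
    exact ⟨Representation.Coinvariants.mk _ v, (Representation.Coinvariants.mk_eq_iff _).2 hv⟩

theorem extendEmb_castSuccEmb (n : ℕ) :
    FI.extendEmb (Fin.castSuccEmb : Fin n ↪ Fin (n + 1)) = Fin.castSuccEmb := by
  refine Function.Embedding.ext fun i => ?_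
  induction i using Fin.cases <;> rfl

theorem shift_coinvMap_bijective_iff {a n : ℕ} (h : a ≤ n) :
    Function.Bijective (V.shift.coinvMap h) ↔
      Function.Bijective (V.coinvMap (Nat.succ_le_succ h)) := by
  rw [Function.Bijective, Function.Bijective, coinvMap_injective_iff, coinvMap_surjective_iff,
    coinvMap_injective_iff, coinvMap_surjective_iff, coinvKer_shift, coinvKer_shift]
  change (∀ v : V.at' (n + 1), V.mapEmb (FI.extendEmb Fin.castSuccEmb) v ∈
      V.coinvKer (a + 1) (n + 1 + 1) → v ∈ V.coinvKer (a + 1) (n + 1)) ∧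
    (∀ w : V.at' (n + 1 + 1), ∃ v : V.at' (n + 1),
      V.mapEmb (FI.extendEmb Fin.castSuccEmb) v - w ∈ V.coinvKer (a + 1) (n + 1 + 1)) ↔ _
  rw [extendEmb_castSuccEmb]

/-- The images of an invariant vector under two injections that both avoid `0` or both hit `0`
agree in the coinvariants. -/
theorem mapEmb_sub_mem_coinvKer {n m : ℕ} {x : V.at' n} (hx : ∀ σ, V.rep n σ x = x)
    (f g : Fin n ↪ Fin (m + 1)) (h : (∃ i, f i = 0) ↔ ∃ i, g i = 0) :
    V.mapEmb f x - V.mapEmb g x ∈ V.coinvKer 1 (m + 1) := by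
  -- If both injections hit `0`, a transposition `σ` of the source aligns the preimages of `0`,
  -- which forces `τ 0 = 0`. If both avoid `0`, extend each by `0 ↦ 0` before choosing `τ`.
  obtain ⟨σ, τ, h0, hτ⟩ : ∃ (σ : Equiv.Perm (Fin n)) (τ : Equiv.Perm (Fin (m + 1))),
      τ 0 = 0 ∧ ∀ i, τ (g i) = f (σ i) := by
    by_cases hf : ∃ i, f i = 0
    · obtain ⟨j, hj⟩ := h.1 hf
      obtain ⟨i, hi⟩ := hf
      obtain ⟨τ, hτ⟩ := exists_perm_extending g ((Equiv.swap j i).toEmbedding.trans f)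
      refine ⟨Equiv.swap j i, τ, ?_, hτ⟩
      rw [← hj, hτ j, hj, ← hi]
      exact congrArg f (Equiv.swap_apply_left j i)
    · have hg : ¬∃ i, g i = 0 := fun h' => hf (h.2 h')
      push Not at hf hg
      obtain ⟨f', hf'⟩ := exists_eq_succ_trans_extendEmb f hf
      obtain ⟨g', hg'⟩ := exists_eq_succ_trans_extendEmb g hg
      obtain ⟨τ, hτ⟩ := exists_perm_extending (FI.extendEmb g') (FI.extendEmb f')
      refine ⟨1, τ, hτ 0, fun i => ?_⟩
      rw [hf', hg']
      exact hτ i.succ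
  have h1 : V.mapEmb f x = V.rep (m + 1) τ (V.mapEmb g x) := by
    conv_lhs => rw [← hx σ]
    change V.mapEmb f (V.mapEmb σ.toEmbedding x) = V.mapEmb τ.toEmbedding (V.mapEmb g x)
    rw [mapEmb_mapEmb, mapEmb_mapEmb]
    congr 1
    congr 1
    exact Function.Embedding.ext fun i => (hτ i).symm
  rw [h1]
  refine Representation.Coinvariants.sub_mem_ker (ρ := V.repFix 1 (m + 1)) ⟨τ, fun i hi => ?_⟩ _
  obtain rfl : i = 0 := Fin.ext (by simpa using hi)
  exact h0

/-- Replace `v` by its orbit sum `x`. Modulo the stabilizer of `0` in `S_{n+2}`, the image of `x`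
under `f : [n] → [n+2]` has a value `A` if `f` hits `0` and `B` if it avoids `0`. The vanishing of
the orbit sum of the image of `x` in `V_{n+1}`, pushed forward to `V_{n+2}`, gives relations that
force `B = 0` and then `A = 0`. The two injectivity hypotheses for `a = 1` then bring the vanishing
back from `V_{n+2}` to `V_n`. -/
theorem coinvMap_zero_injective {n : ℕ} (hn : 1 ≤ n)
    (h1 : Function.Injective (V.coinvMap hn))
    (h2 : Function.Injective (V.coinvMap (Nat.le_succ_of_le hn))) :
    Function.Injective (V.coinvMap n.zero_le) := by
  rw [coinvMap_injective_iff] at h1 h2 ⊢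
  intro v hv
  rw [coinvKer_zero] at hv ⊢
  set x : V.at' n := ∑ σ, V.rep n σ v with hx
  have hinv : ∀ σ, V.rep n σ x = x := fun σ => rep_sum_rep _ σ v
  have hxv := sum_rep_sub_smul_mem_ker (V.rep n) v
  have hcard : (Fintype.card (Equiv.Perm (Fin n)) : ℂ) ≠ 0 := Nat.cast_ne_zero.2 Fintype.card_ne_zero
  have hmap : Representation.Coinvariants.ker (V.rep n) ≤
      (Representation.Coinvariants.ker (V.rep (n + 1))).comap (V.mapEmb Fin.castSuccEmb) := by
    refine Submodule.span_le.2 ?_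
    rintro _ ⟨⟨σ, w⟩, rfl⟩
    rw [SetLike.mem_coe, Submodule.mem_comap, map_sub,
      V.mapEmb_castSucc_rep σ (permCastSucc σ) fun i => (permCastSucc_castSucc σ i).symm]
    exact Representation.Coinvariants.sub_mem_ker _ _
  have hιx : V.mapEmb Fin.castSuccEmb x ∈ Representation.Coinvariants.ker (V.rep (n + 1)) := by
    have h := hmap hxv
    rw [Submodule.mem_comap, map_sub, map_smul] at h
    exact (Submodule.sub_mem_iff_left _ (Submodule.smul_mem _ _ hv)).1 h
  have hsum : ∀ g : Fin (n + 1) ↪ Fin (n + 2), ∑ τ : Equiv.Perm (Fin (n + 1)),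
      V.mapEmb ((Fin.castSuccEmb.trans τ.toEmbedding).trans g) x = 0 := by
    intro g
    have h := congrArg (V.mapEmb g) (sum_rep_eq_zero hιx)
    rw [map_sum, map_zero] at h
    rw [← h]
    refine Finset.sum_congr rfl fun τ _ => ?_
    rw [← mapEmb_mapEmb, ← mapEmb_mapEmb]
    rfl
  -- Push forward along `Fin.succEmb`: every composite avoids `0`, and the relation reads `(n+1)! B
  -- = 0`.
  have hb : ∀ f : Fin n ↪ Fin (n + 2), (¬∃ i, f i = 0) →
      V.mapEmb f x ∈ V.coinvKer 1 (n + 2) := by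
    intro f hf
    have h : ∑ τ : Equiv.Perm (Fin (n + 1)), (V.mapEmb f x - V.mapEmb
        ((Fin.castSuccEmb.trans τ.toEmbedding).trans (Fin.succEmb (n + 1))) x) ∈
        V.coinvKer 1 (n + 2) := by
      refine sum_mem fun τ _ => mapEmb_sub_mem_coinvKer hinv _ _ (iff_of_false hf ?_)
      rintro ⟨i, hi⟩
      exact Fin.succ_ne_zero _ hi
    rw [Finset.sum_sub_distrib, hsum, sub_zero, Finset.sum_const, ← Nat.cast_smul_eq_nsmul ℂ] at h
    exact (Submodule.smul_mem_iff _ (Nat.cast_ne_zero.2 Fintype.card_ne_zero)).1 h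
  -- Push forward along `Fin.castSuccEmb`: since `B = 0`, only the composites that hit `0`
  -- contribute, each with value `A`. The term `τ = 1` is among them because `n ≥ 1`, so the
  -- coefficient of `A` is not zero.
  have ha : V.mapEmb Fin.castSuccEmb (V.mapEmb Fin.castSuccEmb x) ∈ V.coinvKer 1 (n + 2) := by
    classical
    rw [mapEmb_mapEmb]
    set f₀ : Fin n ↪ Fin (n + 2) := Fin.castSuccEmb.trans Fin.castSuccEmb with hf₀
    have h0 : ∃ i, f₀ i = 0 := ⟨⟨0, hn⟩, rfl⟩
    let f : Equiv.Perm (Fin (n + 1)) → (Fin n ↪ Fin (n + 2)) := fun τ =>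
      (Fin.castSuccEmb.trans τ.toEmbedding).trans Fin.castSuccEmb
    have h : ∑ τ : Equiv.Perm (Fin (n + 1)),
        ((if ∃ i, f τ i = 0 then V.mapEmb f₀ x else 0) - V.mapEmb (f τ) x) ∈
        V.coinvKer 1 (n + 2) := by
      refine sum_mem fun τ _ => ?_
      split_ifs with hτ
      · exact mapEmb_sub_mem_coinvKer hinv _ _ (iff_of_true h0 hτ)
      · rw [zero_sub]
        exact neg_mem (hb _ hτ)
    rw [Finset.sum_sub_distrib, hsum, sub_zero, ← Finset.sum_filter, Finset.sum_const,
      ← Nat.cast_smul_eq_nsmul ℂ] at h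
    refine (Submodule.smul_mem_iff _ (Nat.cast_ne_zero.2 ?_)).1 h
    exact Finset.card_ne_zero_of_mem (a := 1) (Finset.mem_filter.2 ⟨Finset.mem_univ _, h0⟩)
  -- The vector `x` dies in the coinvariants of the stabilizer of `0`, hence in those of all of
  -- `S_n`, where `x` represents `n! v`.
  have hx0 := coinvKer_anti (Nat.zero_le 1) (h1 _ (h2 _ ha))
  rw [coinvKer_zero] at hx0
  exact (Submodule.smul_mem_iff _ hcard).1 ((Submodule.sub_mem_iff_right _ hx0).1 hxv)

theorem HasStabilityDegreeLE.shift {N : ℕ} (h : V.HasStabilityDegreeLE N) :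
    V.shift.HasStabilityDegreeLE N := fun a n han =>
  (shift_coinvMap_bijective_iff _).2 (h (a + 1) (n + 1) (Nat.succ_le_succ han))

theorem HasStabilityDegreeLE.of_shift {N : ℕ} (h : V.shift.HasStabilityDegreeLE N) :
    V.HasStabilityDegreeLE (N + 1) := by
  have key : ∀ (a n : ℕ) (han : N + a ≤ n),
      Function.Bijective (V.coinvMap (Nat.succ_le_succ ((Nat.le_add_left a N).trans han))) :=
    fun a n han => (shift_coinvMap_bijective_iff _).1 (h a n han)
  -- For positive `a` the bound `N` would be enough. The case `a = 0` uses the shift at `(0, n)` and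
  -- `(0, n + 1)` for degree `n + 1` of `V`, so it needs `N ≤ n`; this is where `N + 1` comes from.
  rintro (_ | a) (_ | n) han
  · omega
  · refine ⟨coinvMap_zero_injective (by omega) (key 0 n (by omega)).1 (key 0 (n + 1) (by omega)).1,
      (coinvMap_surjective_iff _).2 fun w => ?_⟩
    obtain ⟨v, hv⟩ := (coinvMap_surjective_iff _).1 (key 0 n (by omega)).2 w
    exact ⟨v, coinvKer_anti (Nat.zero_le _) hv⟩
  · omega
  · exact key a n (by omega)

end FIModule

/-! ### Group algebras over `ℂ` -/

section GroupAlgebra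

open scoped MonoidAlgebra

variable {G : Type*} [Group G]

/-- Left multiplication by `z` has trace `|G|` times the coefficient of `1`, and it is nilpotent. -/
theorem coeff_one_eq_zero_of_mul_self_eq_zero [Finite G] {z : ℂ[G]} (hz : z * z = 0) :
    z.coeff 1 = 0 := by
  classical
  have := Fintype.ofFinite G
  have hnil : IsNilpotent (LinearMap.mulLeft ℂ z) :=
    ⟨2, by rw [LinearMap.pow_mulLeft, pow_two, hz, LinearMap.mulLeft_zero_eq_zero]⟩
  have htr := (LinearMap.isNilpotent_trace_of_isNilpotent hnil).eq_zero
  rw [LinearMap.trace_eq_matrix_trace ℂ (MonoidAlgebra.basis G ℂ), Matrix.trace] at htr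
  have hdiag : ∀ g : G, (LinearMap.toMatrix (MonoidAlgebra.basis G ℂ) (MonoidAlgebra.basis G ℂ)
      (LinearMap.mulLeft ℂ z)).diag g = z.coeff 1 := by
    intro g
    rw [Matrix.diag_apply, LinearMap.toMatrix_apply]
    change (z * MonoidAlgebra.single g 1).coeff g = _
    rw [MonoidAlgebra.coeff_mul_single_apply, mul_inv_cancel, mul_one]
  simp only [hdiag, Finset.sum_const, Finset.card_univ, nsmul_eq_mul, mul_eq_zero,
    Nat.cast_eq_zero, Fintype.card_ne_zero, false_or] at htr
  exact htr

/-- Semiprimeness of the group algebra: `x g⁻¹` squares to zero, and its coefficient at `1` is the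
coefficient of `x` at `g`. -/
theorem eq_zero_of_forall_mul_mul_eq_zero [Finite G] {x : ℂ[G]} (h : ∀ y, x * y * x = 0) :
    x = 0 := by
  ext g
  have h1 : (x * MonoidAlgebra.single g⁻¹ 1) * (x * MonoidAlgebra.single g⁻¹ 1) = 0 := by
    rw [← mul_assoc, h, zero_mul]
  have h2 := coeff_one_eq_zero_of_mul_self_eq_zero h1
  rw [MonoidAlgebra.coeff_mul_single_apply] at h2
  simpa using h2

/-- The scalar `k` is read off from `c³ = k c²`. Semiprimeness excludes `c² = 0` and `k = 0`, and
then gives `c² = k c`, without computing `k`. -/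
theorem exists_mul_self_eq_smul [Finite G] {c : ℂ[G]} (hc : c ≠ 0)
    (h : ∀ x, ∃ s : ℂ, c * x * c = s • (c * c)) : ∃ k : ℂ, k ≠ 0 ∧ c * c = k • c := by
  have hcc : c * c ≠ 0 := by
    intro h0
    refine hc (eq_zero_of_forall_mul_mul_eq_zero fun y => ?_)
    obtain ⟨s, hs⟩ := h y
    rw [hs, h0, smul_zero]
  obtain ⟨k, hk⟩ := h c
  have hk0 : k ≠ 0 := by
    rintro rfl
    refine hcc (eq_zero_of_forall_mul_mul_eq_zero fun y => ?_)
    obtain ⟨s, hs⟩ := h y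
    calc c * c * y * (c * c) = c * (c * y * c) * c := by simp only [mul_assoc]
      _ = s • (c * c * c * c) := by rw [hs]; simp only [mul_smul_comm, smul_mul_assoc, mul_assoc]
      _ = 0 := by rw [hk, zero_smul, zero_mul, smul_zero]
  -- The element `d = c² - k c` factors both as `c (c - k)` and as `(c - k) c`, so `d y d` is a
  -- multiple of `c² (c - k) = c³ - k c² = 0`.
  refine ⟨k, hk0, sub_eq_zero.1 (eq_zero_of_forall_mul_mul_eq_zero fun y => ?_)⟩
  have h0 : (c * c - k • c) * c = 0 := by rw [sub_mul, hk, smul_mul_assoc, sub_self]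
  obtain ⟨s, hs⟩ := h ((c - algebraMap ℂ _ k) * y)
  have h1 : c * c - k • c = c * (c - algebraMap ℂ _ k) := by
    rw [mul_sub, Algebra.algebraMap_eq_smul_one, mul_smul_comm, mul_one]
  have h2 : c * c - k • c = (c - algebraMap ℂ _ k) * c := by
    rw [sub_mul, Algebra.algebraMap_eq_smul_one, smul_mul_assoc, one_mul]
  calc (c * c - k • c) * y * (c * c - k • c)
      = c * ((c - algebraMap ℂ _ k) * y) * (c * (c - algebraMap ℂ _ k)) := by
        rw [h1]; simp only [mul_assoc]
    _ = s • (c * (c * (c - algebraMap ℂ _ k))) := by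
        rw [← mul_assoc, hs]; simp only [smul_mul_assoc, mul_assoc]
    _ = 0 := by rw [← h1, mul_sub, mul_smul_comm, ← mul_assoc, hk, sub_self, smul_zero]

/-- If `c ℂ[G] c` is spanned by `c` and `c u ≠ 0`, then the orbit map of `u` embeds the left ideal
generated by `c`. -/
theorem eq_zero_of_asAlgebraHom_eq_zero [Finite G] {E : Type*} [AddCommGroup E] [Module ℂ E]
    {ρ : Representation ℂ G E} {c : ℂ[G]} (h : ∀ x, ∃ s : ℂ, c * x * c = s • c) {u : E}
    (hu : ρ.asAlgebraHom c u ≠ 0) {x : ℂ[G]} (hx : ρ.asAlgebraHom (x * c) u = 0) :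
    x * c = 0 := by
  refine eq_zero_of_forall_mul_mul_eq_zero fun y => ?_
  obtain ⟨s, hs⟩ := h (y * x)
  -- This element is `s c` and kills `u`, while `c u ≠ 0`; hence `s = 0`.
  have h1 : ρ.asAlgebraHom (c * (y * x) * c) u = 0 := by
    rw [show c * (y * x) * c = c * y * (x * c) by simp only [mul_assoc], map_mul,
      Module.End.mul_apply, hx, map_zero]
  rw [hs, map_smul, LinearMap.smul_apply, smul_eq_zero_iff_left hu] at h1
  calc x * c * y * (x * c) = x * (c * (y * x) * c) := by simp only [mul_assoc]
    _ = 0 := by rw [hs, h1, zero_smul, mul_zero]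

/-- The centre consists of class functions, so its dimension is at most the number of conjugacy
classes. That many independent central elements span it, and `1` is central. -/
theorem one_mem_span_of_central [Finite G] {z : ConjClasses G → ℂ[G]}
    (hz : ∀ i x, z i * x = x * z i) (hli : LinearIndependent ℂ z) :
    (1 : ℂ[G]) ∈ Submodule.span ℂ (Set.range z) := by
  classical
  have := Fintype.ofFinite G
  have := Fintype.ofFinite (ConjClasses G)
  let Φ : (ConjClasses G → ℂ) →ₗ[ℂ] ℂ[G] :=
    { toFun := fun f => ∑ g, MonoidAlgebra.single g (f (ConjClasses.mk g))
      map_add' := fun f f' => by simp [Finset.sum_add_distrib]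
      map_smul' := fun a f => by simp [Finset.smul_sum] }
  have hcentral : ∀ x : ℂ[G], (∀ y, x * y = y * x) → x ∈ LinearMap.range Φ := by
    intro x hx
    have hconj : ∀ g h : G, IsConj g h → x.coeff g = x.coeff h := by
      intro g h hgh
      obtain ⟨a, rfl⟩ := isConj_iff.1 hgh
      have := congrArg (fun w => w.coeff (a * g)) (hx (MonoidAlgebra.single a 1))
      simpa [MonoidAlgebra.coeff_mul_single_apply, MonoidAlgebra.coeff_single_mul_apply]
        using this.symm
    refine ⟨Quotient.lift (s := IsConj.setoid G) (fun g => x.coeff g) hconj, ?_⟩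
    ext g
    change (∑ g', MonoidAlgebra.single g' (x.coeff g')).coeff g = _
    rw [MonoidAlgebra.coeff_sum, Finsupp.finsetSum_apply]
    simp [MonoidAlgebra.coeff_single, Finsupp.single_apply]
  have hle : Submodule.span ℂ (Set.range z) ≤ LinearMap.range Φ :=
    Submodule.span_le.2 (by rintro _ ⟨i, rfl⟩; exact hcentral _ (hz i))
  have hrank : Module.finrank ℂ (LinearMap.range Φ) ≤
      Module.finrank ℂ (Submodule.span ℂ (Set.range z)) := by
    rw [finrank_span_eq_card hli]
    exact (LinearMap.finrank_range_le Φ).trans (Module.finrank_fintype_fun_eq_card ℂ).le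
  rw [Submodule.eq_of_le_of_finrank_le hle hrank]
  exact hcentral 1 fun y => by rw [one_mul, mul_one]

theorem linearIndependent_of_mul_eq_zero {ι A : Type*} [Ring A] [Algebra ℂ A] {z : ι → A}
    (h0 : ∀ i j, i ≠ j → z i * z j = 0) (h1 : ∀ i, z i * z i ≠ 0) : LinearIndependent ℂ z := by
  classical
  rw [linearIndependent_iff']
  intro s a hs i hi
  have h := congrArg (· * z i) hs
  simp only [Finset.sum_mul, smul_mul_assoc, zero_mul] at h
  rw [Finset.sum_eq_single_of_mem i hi (fun j _ hj => by rw [h0 j i hj, smul_zero])] at h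
  exact (smul_eq_zero_iff_left (h1 i)).1 h

/-- The sum of the conjugates of an element of the group algebra. -/
noncomputable def conjSum [Fintype G] (c : ℂ[G]) : ℂ[G] :=
  ∑ g, MonoidAlgebra.single g 1 * c * MonoidAlgebra.single g⁻¹ 1

variable [Fintype G]

theorem conjSum_mul_comm (c x : ℂ[G]) : conjSum c * x = x * conjSum c := by
  induction x using MonoidAlgebra.induction_linear with
  | zero => rw [mul_zero, zero_mul]
  | add x y hx hy => rw [mul_add, add_mul, hx, hy]
  | single h a =>
    rw [conjSum, Finset.sum_mul, Finset.mul_sum,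
      ← Equiv.sum_comp (Equiv.mulLeft h)]
    refine Finset.sum_congr rfl fun g _ => ?_
    simp only [Equiv.coe_mulLeft, mul_assoc, MonoidAlgebra.single_mul_single, mul_inv_rev]
    simp only [← mul_assoc, MonoidAlgebra.single_mul_single, inv_mul_cancel_right, one_mul, mul_one]
    have e (k : G) : MonoidAlgebra.single k a = a • MonoidAlgebra.single k 1 := by
      rw [MonoidAlgebra.smul_single', mul_one]
    rw [e, e, mul_smul_comm, smul_mul_assoc, smul_mul_assoc]

theorem coeff_conjSum_one (c : ℂ[G]) : (conjSum c).coeff 1 = Fintype.card G * c.coeff 1 := by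
  rw [conjSum, MonoidAlgebra.coeff_sum, Finsupp.finsetSum_apply]
  simp [MonoidAlgebra.coeff_mul_single_apply, MonoidAlgebra.coeff_single_mul_apply]

/-- An element of square zero has coefficient `0` at `1`, but conjugation preserves that
coefficient, and the sum multiplies it by `|G|`. -/
theorem conjSum_mul_self_ne_zero {c : ℂ[G]} (h : c.coeff 1 ≠ 0) :
    conjSum c * conjSum c ≠ 0 := by
  intro h0
  have := coeff_one_eq_zero_of_mul_self_eq_zero h0
  rw [coeff_conjSum_one, mul_eq_zero] at this
  exact this.elim (Nat.cast_ne_zero.2 Fintype.card_ne_zero) h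

theorem conjSum_mul_conjSum_eq_zero {c d : ℂ[G]} (h : ∀ x, c * x * d = 0) :
    conjSum c * conjSum d = 0 := by
  rw [conjSum, conjSum, Finset.sum_mul]
  refine Finset.sum_eq_zero fun g _ => ?_
  rw [Finset.mul_sum]
  refine Finset.sum_eq_zero fun k _ => ?_
  calc _ = MonoidAlgebra.single g 1 * (c * (MonoidAlgebra.single g⁻¹ 1 * MonoidAlgebra.single k 1) * d)
        * MonoidAlgebra.single k⁻¹ 1 := by simp only [mul_assoc]
    _ = 0 := by rw [h, mul_zero, zero_mul]

theorem exists_of_conjSum_ne_zero {E : Type*} [AddCommGroup E] [Module ℂ E]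
    {ρ : Representation ℂ G E} {c : ℂ[G]} {u : E} (h : ρ.asAlgebraHom (conjSum c) u ≠ 0) :
    ∃ g, ρ.asAlgebraHom c (ρ g u) ≠ 0 := by
  by_contra! h0
  refine h ?_
  rw [conjSum, map_sum, LinearMap.sum_apply]
  refine Finset.sum_eq_zero fun g _ => ?_
  rw [map_mul, map_mul, Module.End.mul_apply, Module.End.mul_apply,
    Representation.asAlgebraHom_single_one ρ g⁻¹, h0, map_zero]

end GroupAlgebra

/-! ### Counting in Young diagrams -/

namespace YoungDiagram

/-- The number of boxes in the first `k` rows. -/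
def cardRows (mu : YoungDiagram) (k : ℕ) : ℕ :=
  (mu.cells.filter fun x => x.1 < k).card

theorem cardRows_succ (mu : YoungDiagram) (k : ℕ) :
    mu.cardRows (k + 1) = mu.cardRows k + mu.rowLen k := by
  rw [cardRows, cardRows, rowLen_eq_card, row, ← Finset.card_union_of_disjoint]
  · congr 1
    ext x
    simp only [Finset.mem_filter, Finset.mem_union, Nat.lt_succ_iff_lt_or_eq, and_or_left]
  · rw [Finset.disjoint_filter]
    intro x _ h1 h2
    omega

theorem eq_of_cardRows_eq {mu nu : YoungDiagram} (h : ∀ k, mu.cardRows k = nu.cardRows k) :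
    mu = nu := by
  have hrow : ∀ k, mu.rowLen k = nu.rowLen k := fun k => by
    have h1 := h (k + 1)
    rw [cardRows_succ, cardRows_succ, h k] at h1
    exact Nat.add_left_cancel h1
  refine YoungDiagram.ext (Finset.ext fun x => ?_)
  rw [mem_cells, mem_cells]
  exact mem_iff_lt_rowLen.trans (hrow x.1 ▸ mem_iff_lt_rowLen.symm)

theorem cardRows_eq_sum (mu : YoungDiagram) (k : ℕ) :
    mu.cardRows k = ∑ j ∈ Finset.range (mu.rowLen 0), min k (mu.colLen j) := by
  rw [cardRows, Finset.card_eq_sum_card_fiberwise (f := Prod.snd) (t := Finset.range (mu.rowLen 0))]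
  · refine Finset.sum_congr rfl fun j _ => ?_
    rw [← Finset.card_range (min k (mu.colLen j)),
      ← Finset.card_image_of_injective (Finset.range _) (Prod.mk_left_injective j)]
    congr 1
    ext ⟨a, b⟩
    simp only [Finset.mem_filter, mem_cells, mem_iff_lt_colLen, Finset.mem_image, Finset.mem_range,
      lt_min_iff, Prod.mk.injEq]
    constructor
    · rintro ⟨⟨h1, h2⟩, rfl⟩
      exact ⟨a, ⟨h2, h1⟩, rfl, rfl⟩
    · rintro ⟨a', ⟨h1, h2⟩, rfl, rfl⟩
      exact ⟨⟨h2, h1⟩, rfl⟩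
  · rintro ⟨a, b⟩ hx
    have h1 : (a, b) ∈ mu := (Finset.mem_filter.1 hx).1
    simpa using mem_iff_lt_rowLen.1 (mu.up_left_mem (Nat.zero_le a) le_rfl h1)

section Fillings

variable {ι : Type*} [Fintype ι] {mu : YoungDiagram} {r c : ι → ℕ}

theorem col_lt_rowLen (hc : ∀ j, (Finset.univ.filter fun i => c i = j).card = mu.colLen j) (i : ι) :
    c i < mu.rowLen 0 := by
  have h : 0 < mu.colLen (c i) := by
    rw [← hc]
    exact Finset.card_pos.2 ⟨i, by simp⟩
  exact mem_iff_lt_rowLen.1 (mem_iff_lt_colLen.2 h)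

theorem card_filter_col_row_le (hrc : ∀ i j, i ≠ j → c i = c j → r i ≠ r j)
    (hc : ∀ j, (Finset.univ.filter fun i => c i = j).card = mu.colLen j) (j k : ℕ) :
    ((Finset.univ.filter fun i => r i < k).filter fun i => c i = j).card ≤
      min k (mu.colLen j) := by
  refine le_min ?_ ?_
  · rw [← Finset.card_range k]
    refine Finset.card_le_card_of_injOn r (fun i hi => ?_) fun i hi i' hi' h => ?_
    · simp at hi ⊢
      exact hi.1
    · simp at hi hi'
      by_contra hne
      exact hrc i i' hne (hi.2.trans hi'.2.symm) h
  · rw [← hc]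
    refine Finset.card_le_card fun i hi => ?_
    simp at hi ⊢
    exact hi.2

theorem card_filter_row_eq_sum
    (hc : ∀ j, (Finset.univ.filter fun i => c i = j).card = mu.colLen j) (k : ℕ) :
    (Finset.univ.filter fun i => r i < k).card = ∑ j ∈ Finset.range (mu.rowLen 0),
      ((Finset.univ.filter fun i => r i < k).filter fun i => c i = j).card :=
  Finset.card_eq_sum_card_fiberwise fun i _ => by simpa using col_lt_rowLen hc i

/-- The dominance inequality. The values of `r` are distinct on each class of `c`, so the class `j`
has at most `min k (mu.colLen j)` elements with `r < k`; sum over `j`. In the application `c` is the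
column in one tableau and `r` the row in another. -/
theorem card_filter_row_le_cardRows (hrc : ∀ i j, i ≠ j → c i = c j → r i ≠ r j)
    (hc : ∀ j, (Finset.univ.filter fun i => c i = j).card = mu.colLen j) (k : ℕ) :
    (Finset.univ.filter fun i => r i < k).card ≤ mu.cardRows k := by
  rw [card_filter_row_eq_sum hc, cardRows_eq_sum]
  exact Finset.sum_le_sum fun j _ => card_filter_col_row_le hrc hc j k

/-- Equality in the dominance inequality forces equality column by column. With `k` the length of
the column of `i`, all elements of that column have `r < k`. -/
theorem mem_of_card_filter_row_eq (hrc : ∀ i j, i ≠ j → c i = c j → r i ≠ r j)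
    (hc : ∀ j, (Finset.univ.filter fun i => c i = j).card = mu.colLen j)
    (hr : ∀ k, (Finset.univ.filter fun i => r i < k).card = mu.cardRows k) (i : ι) :
    (r i, c i) ∈ mu := by
  have h := hr (mu.colLen (c i))
  rw [card_filter_row_eq_sum hc, cardRows_eq_sum, Finset.sum_eq_sum_iff_of_le
    fun j _ => card_filter_col_row_le hrc hc j _] at h
  have h1 := h (c i) (Finset.mem_range.2 (col_lt_rowLen hc i))
  rw [min_self, ← hc, Finset.filter_filter] at h1
  have h2 := Finset.eq_of_subset_of_card_le (fun x hx => by simp at hx ⊢; exact hx.2) h1.ge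
  have h3 : i ∈ Finset.univ.filter fun i' => c i' = c i := by simp
  rw [← h2] at h3
  exact mem_iff_lt_colLen.2 (hc (c i) ▸ (Finset.mem_filter.1 h3).2.1)

end Fillings

/-! ### Young diagrams from partitions. -/

theorem card_cellsOfRowLens (w : List ℕ) : (YoungDiagram.cellsOfRowLens w).card = w.sum := by
  induction w with
  | nil => rfl
  | cons a w ih =>
    rw [YoungDiagram.cellsOfRowLens, Finset.card_union_of_disjoint, Finset.card_map, ih]
    · simp
    · rw [Finset.disjoint_left]
      rintro ⟨x, y⟩ h1 h2
      simp at h1 h2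
      omega

/-- The Young diagram whose row lengths are the parts of a partition. -/
def ofPartition {n : ℕ} (p : n.Partition) : YoungDiagram :=
  ofRowLens (p.parts.sort (· ≥ ·)) (Multiset.pairwise_sort _ _).sortedGE

theorem card_ofPartition {n : ℕ} (p : n.Partition) : (ofPartition p).card = n := by
  change (YoungDiagram.cellsOfRowLens _).card = n
  rw [card_cellsOfRowLens, ← Multiset.sum_coe, Multiset.sort_eq, p.parts_sum]

theorem ofPartition_injective (n : ℕ) : Function.Injective (ofPartition (n := n)) := by
  intro p q h
  have h1 : ∀ p : n.Partition, ((ofPartition p).rowLens : Multiset ℕ) = p.parts := fun p => by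
    rw [ofPartition, rowLens_ofRowLens_eq_self fun x hx => p.parts_pos ((Multiset.mem_sort _).1 hx),
      Multiset.sort_eq]
  exact Nat.Partition.ext (by rw [← h1, ← h1, h])

end YoungDiagram

/-! ### Symmetrizers -/

section Symmetrizers

open scoped MonoidAlgebra

variable {n : ℕ}

open scoped Classical in
/-- The sum of the permutations that preserve a colouring. -/
noncomputable def symmetrizer (f : Fin n → ℕ) : ℂ[Equiv.Perm (Fin n)] :=
  ∑ p : Equiv.Perm (Fin n) with ∀ k, f (p k) = f k, MonoidAlgebra.single p (1 : ℂ)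

open scoped Classical in
/-- The signed sum of the permutations that preserve a colouring. -/
noncomputable def antisymmetrizer (f : Fin n → ℕ) : ℂ[Equiv.Perm (Fin n)] :=
  ∑ q : Equiv.Perm (Fin n) with ∀ k, f (q k) = f k,
    MonoidAlgebra.single q ((Equiv.Perm.sign q : ℤ) : ℂ)

theorem preserves_mul_left_iff {f : Fin n → ℕ} {p q : Equiv.Perm (Fin n)}
    (hp : ∀ k, f (p k) = f k) : (∀ k, f ((p * q) k) = f k) ↔ ∀ k, f (q k) = f k := by
  simp only [Equiv.Perm.mul_apply, hp]

theorem preserves_mul_right_iff {f : Fin n → ℕ} {p q : Equiv.Perm (Fin n)}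
    (hp : ∀ k, f (p k) = f k) : (∀ k, f ((q * p) k) = f k) ↔ ∀ k, f (q k) = f k := by
  refine ⟨fun h k => ?_, fun h k => (h (p k)).trans (hp k)⟩
  obtain ⟨k, rfl⟩ := p.surjective k
  exact (h k).trans (hp k).symm

theorem single_mul_symmetrizer {f : Fin n → ℕ} {p : Equiv.Perm (Fin n)}
    (hp : ∀ k, f (p k) = f k) : MonoidAlgebra.single p 1 * symmetrizer f = symmetrizer f := by
  classical
  rw [symmetrizer, Finset.mul_sum]
  refine Finset.sum_equiv (Equiv.mulLeft p) (fun q => ?_) fun q _ => ?_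
  · simp only [Finset.mem_filter, Finset.mem_univ, true_and, Equiv.coe_mulLeft,
      preserves_mul_left_iff hp]
  · rw [MonoidAlgebra.single_mul_single, one_mul, Equiv.coe_mulLeft]

theorem symmetrizer_mul_single {f : Fin n → ℕ} {p : Equiv.Perm (Fin n)}
    (hp : ∀ k, f (p k) = f k) : symmetrizer f * MonoidAlgebra.single p 1 = symmetrizer f := by
  classical
  rw [symmetrizer, Finset.sum_mul]
  refine Finset.sum_equiv (Equiv.mulRight p) (fun q => ?_) fun q _ => ?_
  · simp only [Finset.mem_filter, Finset.mem_univ, true_and, Equiv.coe_mulRight,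
      preserves_mul_right_iff hp]
  · rw [MonoidAlgebra.single_mul_single, one_mul, Equiv.coe_mulRight]

theorem sign_cast_mul_self (p : Equiv.Perm (Fin n)) :
    ((Equiv.Perm.sign p : ℤ) : ℂ) * ((Equiv.Perm.sign p : ℤ) : ℂ) = 1 := by
  rw [← Int.cast_mul, ← Units.val_mul, Int.units_mul_self, Units.val_one, Int.cast_one]

theorem single_mul_antisymmetrizer {f : Fin n → ℕ} {p : Equiv.Perm (Fin n)}
    (hp : ∀ k, f (p k) = f k) : MonoidAlgebra.single p 1 * antisymmetrizer f =
      ((Equiv.Perm.sign p : ℤ) : ℂ) • antisymmetrizer f := by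
  classical
  rw [antisymmetrizer, Finset.mul_sum, Finset.smul_sum]
  refine Finset.sum_equiv (Equiv.mulLeft p) (fun q => ?_) fun q _ => ?_
  · simp only [Finset.mem_filter, Finset.mem_univ, true_and, Equiv.coe_mulLeft,
      preserves_mul_left_iff hp]
  · rw [MonoidAlgebra.single_mul_single, one_mul, Equiv.coe_mulLeft, MonoidAlgebra.smul_single',
      Equiv.Perm.sign_mul, Units.val_mul, Int.cast_mul, ← mul_assoc, sign_cast_mul_self, one_mul]

theorem antisymmetrizer_mul_single {f : Fin n → ℕ} {p : Equiv.Perm (Fin n)}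
    (hp : ∀ k, f (p k) = f k) : antisymmetrizer f * MonoidAlgebra.single p 1 =
      ((Equiv.Perm.sign p : ℤ) : ℂ) • antisymmetrizer f := by
  classical
  rw [antisymmetrizer, Finset.sum_mul, Finset.smul_sum]
  refine Finset.sum_equiv (Equiv.mulRight p) (fun q => ?_) fun q _ => ?_
  · simp only [Finset.mem_filter, Finset.mem_univ, true_and, Equiv.coe_mulRight,
      preserves_mul_right_iff hp]
  · rw [MonoidAlgebra.single_mul_single, mul_one, Equiv.coe_mulRight, MonoidAlgebra.smul_single',
      Equiv.Perm.sign_mul, Units.val_mul, Int.cast_mul, mul_left_comm, sign_cast_mul_self, mul_one]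

theorem single_mul_symmetrizer_eq (g : Equiv.Perm (Fin n)) (f : Fin n → ℕ) :
    MonoidAlgebra.single g 1 * symmetrizer f =
      symmetrizer (f ∘ ⇑g⁻¹) * MonoidAlgebra.single g 1 := by
  classical
  rw [symmetrizer, symmetrizer, Finset.mul_sum, Finset.sum_mul]
  refine Finset.sum_equiv (MulAut.conj g).toEquiv (fun q => ?_) fun q _ => ?_
  · simp only [Finset.mem_filter, Finset.mem_univ, true_and]
    constructor
    · intro h k
      simpa using h (g⁻¹ k)
    · intro h k
      simpa using h (g k)
  · simp [MonoidAlgebra.single_mul_single]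

theorem preserves_swap {f : Fin n → ℕ} {i j : Fin n} (h : f i = f j) (k : Fin n) :
    f (Equiv.swap i j k) = f k := by
  rw [Equiv.swap_apply_def]
  split_ifs with h1 h2
  · rw [h1, h]
  · rw [h2, h]
  · rfl

/-- The transposition of `i` and `j` can be absorbed by either factor, with sign `-1` on the left
and `1` on the right, so the product equals its negative. -/
theorem antisymmetrizer_mul_symmetrizer {f c : Fin n → ℕ} {i j : Fin n} (hij : i ≠ j)
    (hf : f i = f j) (hc : c i = c j) : antisymmetrizer c * symmetrizer f = 0 := by
  have h := antisymmetrizer_mul_single (preserves_swap hc)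
  rw [Equiv.Perm.sign_swap hij] at h
  have h1 : antisymmetrizer c * symmetrizer f = -(antisymmetrizer c * symmetrizer f) := by
    conv_lhs => rw [← single_mul_symmetrizer (preserves_swap hf), ← mul_assoc, h]
    simp
  rw [eq_neg_iff_add_eq_zero, ← two_smul ℂ] at h1
  exact (smul_eq_zero_iff_right (two_ne_zero : (2 : ℂ) ≠ 0)).1 h1

theorem symmetrizer_mul_antisymmetrizer {f c : Fin n → ℕ} {i j : Fin n} (hij : i ≠ j)
    (hf : f i = f j) (hc : c i = c j) : symmetrizer f * antisymmetrizer c = 0 := by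
  have h := single_mul_antisymmetrizer (preserves_swap hc)
  rw [Equiv.Perm.sign_swap hij] at h
  have h1 : symmetrizer f * antisymmetrizer c = -(symmetrizer f * antisymmetrizer c) := by
    conv_lhs => rw [← symmetrizer_mul_single (preserves_swap hf), mul_assoc, h]
    simp
  rw [eq_neg_iff_add_eq_zero, ← two_smul ℂ] at h1
  exact (smul_eq_zero_iff_right (two_ne_zero : (2 : ℂ) ≠ 0)).1 h1

open scoped Classical in
/-- The number of permutations that preserve a colouring. -/
noncomputable def numPreserving (f : Fin n → ℕ) : ℕ :=
  (Finset.univ.filter fun p : Equiv.Perm (Fin n) => ∀ k, f (p k) = f k).card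

theorem numPreserving_ne_zero (f : Fin n → ℕ) : (numPreserving f : ℂ) ≠ 0 :=
  Nat.cast_ne_zero.2 (Finset.card_ne_zero_of_mem (a := 1) (by simp))

theorem symmetrizer_mul_symmetrizer {f f' : Fin n → ℕ} (h : ∀ i j, f i = f j → f' i = f' j) :
    symmetrizer f * symmetrizer f' = (numPreserving f : ℂ) • symmetrizer f' := by
  classical
  rw [numPreserving, symmetrizer, Finset.sum_mul, Nat.cast_smul_eq_nsmul, ← Finset.sum_const]
  exact Finset.sum_congr (by congr) fun p hp =>
    single_mul_symmetrizer fun k => h _ _ ((Finset.mem_filter.1 hp).2 k)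

theorem symmetrizer_mul_symmetrizer' {f f' : Fin n → ℕ} (h : ∀ i j, f i = f j → f' i = f' j) :
    symmetrizer f' * symmetrizer f = (numPreserving f : ℂ) • symmetrizer f' := by
  classical
  rw [numPreserving, symmetrizer, symmetrizer, Finset.mul_sum, Nat.cast_smul_eq_nsmul,
    ← Finset.sum_const]
  exact Finset.sum_congr (by congr) fun p hp =>
    symmetrizer_mul_single fun k => h _ _ ((Finset.mem_filter.1 hp).2 k)

/-- A colouring whose only class with more than one element is the given set. -/
def collapse (K : Finset (Fin n)) (i : Fin n) : ℕ :=
  if i ∈ K then 0 else i.val + 1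

theorem collapse_eq_iff {K : Finset (Fin n)} {i j : Fin n} :
    collapse K i = collapse K j ↔ i = j ∨ (i ∈ K ∧ j ∈ K) := by
  unfold collapse
  split_ifs with h1 h2 h2
  · simp [h1, h2]
  · simp only [h1, h2, and_false, or_false]
    exact iff_of_false not_false fun h => h2 (h ▸ h1)
  · simp only [h1, h2, false_and, or_false]
    exact iff_of_false not_false fun h => h1 (h ▸ h2)
  · simp only [h1, false_and, or_false, Fin.ext_iff]
    omega

theorem collapse_comp (K : Finset (Fin n)) (g : Equiv.Perm (Fin n)) :
    symmetrizer (collapse K ∘ g) = symmetrizer (collapse (K.map g⁻¹.toEmbedding)) := by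
  classical
  unfold symmetrizer
  refine Finset.sum_congr (Finset.filter_congr fun p _ => forall_congr' fun k => ?_) fun _ _ => rfl
  have h : ∀ i, i ∈ K.map g⁻¹.toEmbedding ↔ g i ∈ K := fun i => by
    rw [Finset.mem_map_equiv]; rfl
  simp only [Function.comp_apply, collapse_eq_iff, h, g.injective.eq_iff]

/-! ### Young symmetrizers -/

section Tableaux

variable {mu lam : YoungDiagram}

/-- The row of an entry of a tableau. -/
def rowIdx (T : Fin n ≃ mu.cells) (k : Fin n) : ℕ := (T k).1.1

/-- The column of an entry of a tableau. -/
def colIdx (T : Fin n ≃ mu.cells) (k : Fin n) : ℕ := (T k).1.2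

theorem youngSymmetrizer_eq (T : Fin n ≃ mu.cells) :
    youngSymmetrizer T = symmetrizer (rowIdx T) * antisymmetrizer (colIdx T) :=
  rfl

theorem eq_of_rowIdx_eq_of_colIdx_eq (T : Fin n ≃ mu.cells) {i j : Fin n}
    (hr : rowIdx T i = rowIdx T j) (hc : colIdx T i = colIdx T j) : i = j :=
  T.injective (Subtype.ext (Prod.ext hr hc))

theorem card_filter_tableau (T : Fin n ≃ mu.cells) (P : ℕ × ℕ → Prop) [DecidablePred P] :
    (Finset.univ.filter fun i => P (T i).1).card = (mu.cells.filter P).card := by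
  refine Finset.card_bij (fun i _ => (T i).1) (fun i hi => ?_) (fun i _ j _ h => ?_) fun x hx => ?_
  · exact Finset.mem_filter.2 ⟨(T i).2, (Finset.mem_filter.1 hi).2⟩
  · exact T.injective (Subtype.ext h)
  · obtain ⟨h1, h2⟩ := Finset.mem_filter.1 hx
    refine ⟨T.symm ⟨x, h1⟩, ?_, ?_⟩
    · simpa using h2
    · simp

theorem card_filter_colIdx (T : Fin n ≃ mu.cells) (j : ℕ) :
    (Finset.univ.filter fun i => colIdx T i = j).card = mu.colLen j := by
  rw [YoungDiagram.colLen_eq_card]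
  exact card_filter_tableau T fun x => x.2 = j

theorem card_filter_rowIdx_lt (T : Fin n ≃ mu.cells) (k : ℕ) :
    (Finset.univ.filter fun i => rowIdx T i < k).card = mu.cardRows k :=
  card_filter_tableau T fun x => x.1 < k

theorem card_filter_rowIdx_comp_lt (T : Fin n ≃ mu.cells) (g : Equiv.Perm (Fin n)) (k : ℕ) :
    (Finset.univ.filter fun i => (rowIdx T ∘ g) i < k).card = mu.cardRows k :=
  card_filter_rowIdx_lt (g.trans T) k

/-- A permutation preserving both rows and columns is the identity, so `p q = 1` only for `p = q =
1`. -/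
theorem coeff_youngSymmetrizer_one (T : Fin n ≃ mu.cells) : (youngSymmetrizer T).coeff 1 = 1 := by
  classical
  rw [youngSymmetrizer_eq, symmetrizer, antisymmetrizer, Finset.sum_mul, MonoidAlgebra.coeff_sum,
    Finsupp.finsetSum_apply, Finset.sum_eq_single_of_mem 1 (by simp)]
  · rw [Finset.mul_sum, MonoidAlgebra.coeff_sum,
      Finsupp.finsetSum_apply, Finset.sum_eq_single_of_mem 1 (by simp)]
    · simp [MonoidAlgebra.single_mul_single, MonoidAlgebra.coeff_single]
    · intro q _ hq
      simp [MonoidAlgebra.single_mul_single, MonoidAlgebra.coeff_single, hq]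
  · intro p hp hp1
    rw [Finset.mul_sum, MonoidAlgebra.coeff_sum, Finsupp.finsetSum_apply]
    refine Finset.sum_eq_zero fun q hq => ?_
    rw [MonoidAlgebra.single_mul_single, MonoidAlgebra.coeff_single, Finsupp.single_apply,
      if_neg]
    intro hpq
    refine hp1 (Equiv.ext fun k => ?_)
    have h1 := (Finset.mem_filter.1 hp).2 k
    have h2 := (Finset.mem_filter.1 hq).2 (p k)
    have h3 : q (p k) = k := by
      have := mul_eq_one_iff_eq_inv'.1 hpq
      rw [this]
      exact p.symm_apply_apply k
    rw [h3] at h2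
    exact eq_of_rowIdx_eq_of_colIdx_eq T h1 h2.symm

theorem youngSymmetrizer_ne_zero (T : Fin n ≃ mu.cells) : youngSymmetrizer T ≠ 0 := by
  intro h
  have := coeff_youngSymmetrizer_one T
  rw [h] at this
  exact zero_ne_one this

/-- Two entries in a column of `T` are never in a row of the translate of `S`, unless the product
of the symmetrizers vanishes. -/
theorem antisymmetrizer_mul_single_mul_symmetrizer (c f : Fin n → ℕ) (g : Equiv.Perm (Fin n)) :
    antisymmetrizer c * MonoidAlgebra.single g 1 * symmetrizer f = 0 ∨
      ∀ i j, i ≠ j → c i = c j → (f ∘ ⇑g⁻¹) i ≠ (f ∘ ⇑g⁻¹) j := by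
  by_contra! h
  obtain ⟨h0, i, j, hij, hc, hf⟩ := h
  refine h0 ?_
  rw [mul_assoc, single_mul_symmetrizer_eq, ← mul_assoc,
    antisymmetrizer_mul_symmetrizer hij hf hc, zero_mul]

theorem youngSymmetrizer_mul_mul (T : Fin n ≃ mu.cells) (S : Fin n ≃ lam.cells)
    (x : ℂ[Equiv.Perm (Fin n)]) : youngSymmetrizer T * x * youngSymmetrizer S =
      symmetrizer (rowIdx T) * (antisymmetrizer (colIdx T) * x * symmetrizer (rowIdx S)) *
        antisymmetrizer (colIdx S) := by
  simp only [youngSymmetrizer_eq, mul_assoc]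

theorem single_eq_smul (g : Equiv.Perm (Fin n)) (a : ℂ) :
    MonoidAlgebra.single g a = a • MonoidAlgebra.single g (1 : ℂ) := by
  rw [MonoidAlgebra.smul_single', mul_one]

/-- If a middle factor `b_T g a_S` does not vanish, no two entries of a column of `T` share a row of
the translate of `S`, and the dominance inequality contradicts `h`. -/
theorem youngSymmetrizer_mul_mul_eq_zero (T : Fin n ≃ mu.cells) (S : Fin n ≃ lam.cells) {k : ℕ}
    (h : mu.cardRows k < lam.cardRows k) (x : ℂ[Equiv.Perm (Fin n)]) :
    youngSymmetrizer T * x * youngSymmetrizer S = 0 := by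
  induction x using MonoidAlgebra.induction_linear with
  | zero => rw [mul_zero, zero_mul]
  | add x y hx hy => rw [mul_add, add_mul, hx, hy, add_zero]
  | single g a =>
    rw [single_eq_smul, mul_smul_comm, smul_mul_assoc, youngSymmetrizer_mul_mul]
    rcases antisymmetrizer_mul_single_mul_symmetrizer (colIdx T) (rowIdx S) g with h0 | h0
    · rw [h0, mul_zero, zero_mul, smul_zero]
    · have := YoungDiagram.card_filter_row_le_cardRows h0 (card_filter_colIdx T) k
      rw [card_filter_rowIdx_comp_lt] at this
      exact absurd h this.not_gt

/-- Write `c = a b` with `a` the row and `b` the column factor. Each `b g a` is `0` or `± b a`, and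
`a (b a) b = c * c`; this is why the multiple is of `c * c` and not yet of `c`. -/
theorem exists_youngSymmetrizer_mul_mul (T : Fin n ≃ mu.cells) (x : ℂ[Equiv.Perm (Fin n)]) :
    ∃ s : ℂ, youngSymmetrizer T * x * youngSymmetrizer T =
      s • (youngSymmetrizer T * youngSymmetrizer T) := by
  induction x using MonoidAlgebra.induction_linear with
  | zero => exact ⟨0, by rw [mul_zero, zero_mul, zero_smul]⟩
  | add x y hx hy =>
    obtain ⟨s, hs⟩ := hx
    obtain ⟨t, ht⟩ := hy
    exact ⟨s + t, by rw [mul_add, add_mul, hs, ht, add_smul]⟩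
  | single g a =>
    suffices h : ∃ s : ℂ, antisymmetrizer (colIdx T) * MonoidAlgebra.single g 1 *
        symmetrizer (rowIdx T) = s • (antisymmetrizer (colIdx T) * symmetrizer (rowIdx T)) by
      obtain ⟨s, hs⟩ := h
      refine ⟨a * s, ?_⟩
      rw [single_eq_smul, mul_smul_comm, smul_mul_assoc, youngSymmetrizer_mul_mul, hs, mul_smul,
        mul_smul_comm, smul_mul_assoc]
      simp only [youngSymmetrizer_eq, mul_assoc]
    rcases antisymmetrizer_mul_single_mul_symmetrizer (colIdx T) (rowIdx T) g with h0 | h0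
    · exact ⟨0, by rw [h0, zero_smul]⟩
    have hmem := YoungDiagram.mem_of_card_filter_row_eq h0 (card_filter_colIdx T)
      (card_filter_rowIdx_comp_lt T g⁻¹)
    -- Move each entry inside its column of `T` to the row that it has in the translate by `g`. This
    -- gives `q` in the column group with `q g` in the row group, so `g = q⁻¹ (q g)` is absorbed on
    -- both sides.
    let e : Fin n → Fin n := fun i => T.symm ⟨((rowIdx T ∘ ⇑g⁻¹) i, colIdx T i), hmem i⟩
    have hcol : ∀ i, colIdx T (e i) = colIdx T i := fun i => by simp [e, colIdx]
    have hrow : ∀ i, rowIdx T (e i) = rowIdx T (g⁻¹ i) := fun i => by simp [e, rowIdx]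
    have hinj : Function.Injective e := by
      intro i j hij
      by_contra hne
      exact h0 i j hne (by rw [← hcol i, hij, hcol]) ((hrow i).symm.trans (hij ▸ hrow j))
    let q : Equiv.Perm (Fin n) := Equiv.ofBijective e (Finite.injective_iff_bijective.1 hinj)
    have hq : ∀ i, colIdx T (q⁻¹ i) = colIdx T i := fun i => by
      rw [← hcol (q⁻¹ i)]
      exact congrArg _ (q.apply_symm_apply i)
    have hp : ∀ i, rowIdx T ((q * g) i) = rowIdx T i := fun i => by
      rw [Equiv.Perm.mul_apply]
      exact (hrow (g i)).trans (congrArg _ (g.symm_apply_apply i))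
    have hg : MonoidAlgebra.single g (1 : ℂ) =
        MonoidAlgebra.single q⁻¹ 1 * MonoidAlgebra.single (q * g) 1 := by
      rw [MonoidAlgebra.single_mul_single, inv_mul_cancel_left, one_mul]
    refine ⟨((Equiv.Perm.sign q⁻¹ : ℤ) : ℂ), ?_⟩
    rw [hg, mul_assoc, mul_assoc, single_mul_symmetrizer hp, ← mul_assoc,
      antisymmetrizer_mul_single hq, smul_mul_assoc]

theorem exists_youngSymmetrizer_mul_self (T : Fin n ≃ mu.cells) :
    ∃ k : ℂ, k ≠ 0 ∧ youngSymmetrizer T * youngSymmetrizer T = k • youngSymmetrizer T :=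
  exists_mul_self_eq_smul (youngSymmetrizer_ne_zero T) (exists_youngSymmetrizer_mul_mul T)

/-- Pigeonhole: a set with more elements than `mu` has columns contains two entries of one column,
whatever translate of it is taken. -/
theorem symmetrizer_collapse_mul_youngSymmetrizer (T : Fin n ≃ mu.cells) {K : Finset (Fin n)}
    (h : mu.rowLen 0 < K.card) (x : ℂ[Equiv.Perm (Fin n)]) :
    symmetrizer (collapse K) * (x * youngSymmetrizer T) = 0 := by
  have key : ∀ y, symmetrizer (collapse K) * y * antisymmetrizer (colIdx T) = 0 := by
    intro y
    induction y using MonoidAlgebra.induction_linear with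
    | zero => rw [mul_zero, zero_mul]
    | add x y hx hy => rw [mul_add, add_mul, hx, hy, add_zero]
    | single g a =>
      have hg : symmetrizer (collapse K) * MonoidAlgebra.single g 1 =
          MonoidAlgebra.single g 1 * symmetrizer (collapse K ∘ g) := by
        rw [single_mul_symmetrizer_eq]
        congr 2
        funext i
        simp
      rw [single_eq_smul, mul_smul_comm, smul_mul_assoc, hg, mul_assoc, collapse_comp]
      obtain ⟨i, hi, j, hj, hij, hc⟩ := Finset.exists_ne_map_eq_of_card_lt_of_maps_to
        (s := K.map g⁻¹.toEmbedding) (t := Finset.range (mu.rowLen 0)) (f := colIdx T)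
        (by rwa [Finset.card_range, Finset.card_map])
        (fun i _ => by simpa using YoungDiagram.col_lt_rowLen (card_filter_colIdx T) i)
      rw [symmetrizer_mul_antisymmetrizer hij (collapse_eq_iff.2 (Or.inr ⟨hi, hj⟩)) hc, mul_zero,
        smul_zero]
  rw [youngSymmetrizer_eq, ← mul_assoc, ← mul_assoc, mul_assoc _ x, key]

/-- Choose `K` inside the first row of `T`. Its symmetric group lies in the row group, so its
symmetrizer acts on the Young symmetrizer by a nonzero scalar. -/
theorem exists_symmetrizer_collapse_mul_ne_zero (T : Fin n ≃ mu.cells) {k : ℕ}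
    (h : k ≤ mu.rowLen 0) :
    ∃ K : Finset (Fin n), K.card = k ∧ symmetrizer (collapse K) * youngSymmetrizer T ≠ 0 := by
  have hcard : k ≤ (Finset.univ.filter fun i => rowIdx T i = 0).card := by
    refine h.trans (le_of_eq ?_)
    rw [YoungDiagram.rowLen_eq_card]
    exact (card_filter_tableau T fun x => x.1 = 0).symm
  obtain ⟨K, hK, hk⟩ := Finset.exists_subset_card_eq hcard
  refine ⟨K, hk, ?_⟩
  rw [youngSymmetrizer_eq, ← mul_assoc, symmetrizer_mul_symmetrizer, smul_mul_assoc]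
  · exact smul_ne_zero (numPreserving_ne_zero _) (youngSymmetrizer_ne_zero T)
  · intro i j hij
    rcases collapse_eq_iff.1 hij with rfl | ⟨hi, hj⟩
    · rfl
    · rw [(Finset.mem_filter.1 (hK hi)).2, (Finset.mem_filter.1 (hK hj)).2]

end Tableaux

end Symmetrizers

/-! ### Constituents -/

section Constituents

open scoped MonoidAlgebra

variable {n : ℕ} {E : Type*} [AddCommGroup E] [Module ℂ E]
  {ρ : Representation ℂ (Equiv.Perm (Fin n)) E}

/-- Some translate of a nonzero vector is not killed by some Young symmetrizer. -/
theorem exists_youngSymmetrizer_apply_ne_zero {u : E} (hu : u ≠ 0) :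
    ∃ (mu : YoungDiagram) (T : Fin n ≃ mu.cells) (g : Equiv.Perm (Fin n)),
      ρ.asAlgebraHom (youngSymmetrizer T) (ρ g u) ≠ 0 := by
  classical
  let part : Equiv.Perm (Fin n) → (Fintype.card (Fin n)).Partition := Equiv.Perm.partition
  -- One diagram for each cycle type. The conjugate sums of the corresponding Young symmetrizers are
  -- central and mutually annihilating, with nonzero squares, and are as many as the conjugacy
  -- classes; so `1` is a combination of them and one of them does not kill `u`.
  let diag : ConjClasses (Equiv.Perm (Fin n)) → YoungDiagram :=
    Quotient.lift (s := IsConj.setoid _) (fun σ => YoungDiagram.ofPartition (part σ))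
      fun σ τ h => congrArg _ (Equiv.Perm.partition_eq_of_isConj.1 h)
  have hdiag : Function.Injective diag := by
    intro C D h
    induction C using Quotient.inductionOn with | h σ
    induction D using Quotient.inductionOn with | h τ
    exact Quotient.sound (Equiv.Perm.partition_eq_of_isConj.2 (YoungDiagram.ofPartition_injective _ h))
  have hcard : ∀ C, (diag C).card = n := by
    intro C
    induction C using Quotient.inductionOn with | h σ
    exact (YoungDiagram.card_ofPartition _).trans (Fintype.card_fin n)
  let T : ∀ C, Fin n ≃ (diag C).cells := fun C => (Finset.equivFinOfCardEq (hcard C)).symm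
  let z : ConjClasses (Equiv.Perm (Fin n)) → ℂ[Equiv.Perm (Fin n)] := fun C =>
    conjSum (youngSymmetrizer (T C))
  have hzz : ∀ C D k, (diag C).cardRows k < (diag D).cardRows k → z C * z D = 0 := fun C D k h =>
    conjSum_mul_conjSum_eq_zero (youngSymmetrizer_mul_mul_eq_zero (T C) (T D) h)
  have hli : LinearIndependent ℂ z := by
    refine linearIndependent_of_mul_eq_zero (fun C D hCD => ?_) fun C =>
      conjSum_mul_self_ne_zero (by rw [coeff_youngSymmetrizer_one]; exact one_ne_zero)
    obtain ⟨k, hk⟩ : ∃ k, (diag C).cardRows k ≠ (diag D).cardRows k := by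
      by_contra! h
      exact hCD (hdiag (YoungDiagram.eq_of_cardRows_eq h))
    rcases lt_or_gt_of_ne hk with h | h
    · exact hzz C D k h
    -- Dominance kills the product in one order only; centrality gives the other.
    · exact (conjSum_mul_comm _ _).trans (hzz D C k h)
  have h1 := one_mem_span_of_central (fun C x => conjSum_mul_comm _ x) hli
  by_contra! h
  have hle : Submodule.span ℂ (Set.range z) ≤
      LinearMap.ker ((LinearMap.applyₗ u).comp ρ.asAlgebraHom.toLinearMap) := by
    refine Submodule.span_le.2 ?_
    rintro _ ⟨C, rfl⟩
    by_contra hC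
    obtain ⟨g, hg⟩ := exists_of_conjSum_ne_zero (ρ := ρ) (u := u) hC
    exact hg (h _ (T C) g)
  have h2 : ρ.asAlgebraHom 1 u = 0 := hle h1
  rw [map_one] at h2
  exact hu h2

open scoped Classical in
theorem asAlgebraHom_symmetrizer_apply (ρ : Representation ℂ (Equiv.Perm (Fin n)) E)
    (f : Fin n → ℕ) (v : E) : ρ.asAlgebraHom (symmetrizer f) v =
      ∑ p : Equiv.Perm (Fin n) with ∀ k, f (p k) = f k, ρ p v := by
  simp only [symmetrizer, map_sum, LinearMap.sum_apply, Representation.asAlgebraHom_single_one]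

/-- The vectors that are killed by the symmetrizers of the subsets with `k` elements. -/
def symKilled (ρ : Representation ℂ (Equiv.Perm (Fin n)) E) (k : ℕ) (v : E) : Prop :=
  ∀ K : Finset (Fin n), K.card = k → ρ.asAlgebraHom (symmetrizer (collapse K)) v = 0

/-- A permutation carries the subsets with `k` elements to each other, so the condition defines a
subrepresentation. -/
theorem symKilled.asAlgebraHom_apply {k : ℕ} {v : E} (h : symKilled ρ k v)
    (x : ℂ[Equiv.Perm (Fin n)]) : symKilled ρ k (ρ.asAlgebraHom x v) := by
  intro K hK
  induction x using MonoidAlgebra.induction_linear with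
  | zero => rw [map_zero, LinearMap.zero_apply, map_zero]
  | add x y hx hy => rw [map_add, LinearMap.add_apply, map_add, hx, hy, add_zero]
  | single g a =>
    have hg : symmetrizer (collapse K) * MonoidAlgebra.single g 1 =
        MonoidAlgebra.single g 1 * symmetrizer (collapse K ∘ g) := by
      rw [single_mul_symmetrizer_eq]
      congr 2
      funext i
      simp
    rw [single_eq_smul, map_smul, LinearMap.smul_apply, map_smul, ← Module.End.mul_apply, ← map_mul,
      hg, map_mul, Module.End.mul_apply, collapse_comp, h _ ((Finset.card_map _).trans hK), map_zero,
      smul_zero]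

theorem asAlgebraHom_symmetrizer_eq_zero_of_subset {K L : Finset (Fin n)} (hLK : L ⊆ K) {v : E}
    (h : ρ.asAlgebraHom (symmetrizer (collapse L)) v = 0) :
    ρ.asAlgebraHom (symmetrizer (collapse K)) v = 0 := by
  have h1 : ρ.asAlgebraHom (symmetrizer (collapse K) * symmetrizer (collapse L)) v = 0 := by
    rw [map_mul, Module.End.mul_apply, h, map_zero]
  rw [symmetrizer_mul_symmetrizer', map_smul, LinearMap.smul_apply] at h1
  · exact (smul_eq_zero_iff_right (numPreserving_ne_zero _)).1 h1
  · exact fun a b hab => collapse_eq_iff.2 ((collapse_eq_iff.1 hab).imp_right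
      (And.imp (@hLK _) (@hLK _)))

theorem symKilled_zero {v : E} (h : symKilled ρ 0 v) : v = 0 := by
  have h1 := h ∅ rfl
  have h2 : symmetrizer (collapse (∅ : Finset (Fin n))) = 1 := by
    classical
    rw [symmetrizer, MonoidAlgebra.one_def, Finset.sum_eq_single_of_mem 1 (by simp)]
    intro p hp hp1
    refine absurd (Equiv.ext fun k => ?_) hp1
    have := collapse_eq_iff.1 ((Finset.mem_filter.1 hp).2 k)
    simpa using this
  rw [h2, map_one] at h1
  exact h1

variable {mu : YoungDiagram}

theorem mul_mem_youngIdeal (T : Fin n ≃ mu.cells) (x : ℂ[Equiv.Perm (Fin n)]) (y : youngIdeal T) :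
    x * y.1 ∈ youngIdeal T := by
  obtain ⟨_, y, rfl⟩ := y
  exact ⟨x * y, by simp [mul_assoc]⟩

theorem asAlgebraHom_intertwining (T : Fin n ≃ mu.cells) (f : (youngRep T).IntertwiningMap ρ)
    (x : ℂ[Equiv.Perm (Fin n)]) (y : youngIdeal T) :
    ρ.asAlgebraHom x (f y) = f ⟨x * y.1, mul_mem_youngIdeal T x y⟩ := by
  induction x using MonoidAlgebra.induction_linear with
  | zero =>
    rw [map_zero, LinearMap.zero_apply]
    refine (map_zero f.toLinearMap).symm.trans (congrArg f.toLinearMap (Subtype.ext ?_))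
    exact (zero_mul _).symm
  | add x x' hx hx' =>
    rw [map_add, LinearMap.add_apply, hx, hx']
    refine (map_add f.toLinearMap _ _).symm.trans (congrArg f.toLinearMap (Subtype.ext ?_))
    exact (add_mul _ _ _).symm
  | single g a =>
    rw [single_eq_smul, map_smul, LinearMap.smul_apply, Representation.asAlgebraHom_single_one]
    have h : ρ g (f y) = f (youngRep T g y) := (LinearMap.congr_fun (f.isIntertwining' g) y).symm
    rw [h]
    refine (map_smul f.toLinearMap _ _).symm.trans (congrArg f.toLinearMap (Subtype.ext ?_))
    exact (smul_mul_assoc _ _ _).symm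

/-- A vector of a representation gives a homomorphism from the left ideal `ℂ[S_n] c_T`. -/
noncomputable def orbitMap (T : Fin n ≃ mu.cells) (ρ : Representation ℂ (Equiv.Perm (Fin n)) E)
    (u : E) : (youngRep T).IntertwiningMap ρ where
  toLinearMap := ((LinearMap.applyₗ u).comp ρ.asAlgebraHom.toLinearMap).comp (youngIdeal T).subtype
  isIntertwining' g := by
    have h (x : ℂ[Equiv.Perm (Fin n)]) :
        ρ.asAlgebraHom (MonoidAlgebra.single g 1 * x) u = ρ g (ρ.asAlgebraHom x u) := by
      rw [map_mul, Module.End.mul_apply, Representation.asAlgebraHom_single_one]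
    exact LinearMap.ext fun y => h y.1

theorem orbitMap_injective (T : Fin n ≃ mu.cells) {u : E}
    (hu : ρ.asAlgebraHom (youngSymmetrizer T) u ≠ 0) : Function.Injective (orbitMap T ρ u) := by
  refine (injective_iff_map_eq_zero (orbitMap T ρ u).toLinearMap).2 ?_
  rintro ⟨_, x, rfl⟩ hx
  obtain ⟨k, -, hk⟩ := exists_youngSymmetrizer_mul_self T
  refine Subtype.ext (eq_zero_of_asAlgebraHom_eq_zero (fun y => ?_) hu hx)
  obtain ⟨s, hs⟩ := exists_youngSymmetrizer_mul_mul T y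
  exact ⟨s * k, by rw [hs, hk, mul_smul]⟩

/-- From a killed vector, some `c_T g v ≠ 0` gives a copy of the ideal of `T` consisting of killed
vectors; a first row of length at least `k` would contain a set `K` whose symmetrizer does not kill
`c_T`. Conversely, the image of `c_T` is killed by pigeonhole on the columns. -/
theorem exists_symKilled_iff {k : ℕ} :
    (∃ v, v ≠ 0 ∧ symKilled ρ k v) ↔ ∃ mu : YoungDiagram, mu.rowLen 0 < k ∧ IsConstituent mu ρ := by
  constructor
  · rintro ⟨v, hv, hk⟩
    obtain ⟨mu, T, g, hT⟩ := exists_youngSymmetrizer_apply_ne_zero (ρ := ρ) hv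
    have hinj := orbitMap_injective T hT
    refine ⟨mu, ?_, T, _, hinj⟩
    by_contra! hle
    obtain ⟨K, hK, hne⟩ := exists_symmetrizer_collapse_mul_ne_zero T hle
    have h1 : symmetrizer (collapse K) * youngSymmetrizer T ∈ youngIdeal T := ⟨_, rfl⟩
    have h2 : orbitMap T ρ (ρ g v) ⟨_, h1⟩ = 0 := by
      change ρ.asAlgebraHom (symmetrizer (collapse K) * youngSymmetrizer T) (ρ g v) = 0
      have h3 := hk.asAlgebraHom_apply (youngSymmetrizer T * MonoidAlgebra.single g 1) K hK
      rwa [map_mul, Module.End.mul_apply, Representation.asAlgebraHom_single_one,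
        ← Module.End.mul_apply, ← map_mul] at h3
    have h4 := (injective_iff_map_eq_zero (orbitMap T ρ (ρ g v)).toLinearMap).1 hinj _ h2
    exact hne (congrArg Subtype.val h4)
  · rintro ⟨mu, hmu, T, f, hf⟩
    have hmem : youngSymmetrizer T ∈ youngIdeal T := ⟨1, by simp⟩
    refine ⟨f ⟨_, hmem⟩, fun h0 => ?_, fun K hK => ?_⟩
    · exact youngSymmetrizer_ne_zero T (congrArg Subtype.val
        ((injective_iff_map_eq_zero f.toLinearMap).1 hf _ h0))
    · rw [asAlgebraHom_intertwining]
      refine (congrArg f.toLinearMap (Subtype.ext ?_)).trans (map_zero f.toLinearMap)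
      have := symmetrizer_collapse_mul_youngSymmetrizer T (hK ▸ hmu) 1
      rwa [one_mul] at this

end Constituents

/-! ### Padded diagrams and the weight -/

theorem mem_paddedDiagram_zero {lam : YoungDiagram} {n : ℕ} {h : lam.card + lam.rowLen 0 ≤ n}
    {j : ℕ} : (0, j) ∈ paddedDiagram lam n h ↔ j < n - lam.card := by
  rw [← YoungDiagram.mem_cells, paddedDiagram]
  simp

theorem mem_paddedDiagram_succ {lam : YoungDiagram} {n : ℕ} {h : lam.card + lam.rowLen 0 ≤ n}
    {i j : ℕ} : (i + 1, j) ∈ paddedDiagram lam n h ↔ (i, j) ∈ lam := by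
  rw [← YoungDiagram.mem_cells, paddedDiagram]
  simp

theorem rowLen_paddedDiagram {lam : YoungDiagram} {n : ℕ} (h : lam.card + lam.rowLen 0 ≤ n) :
    (paddedDiagram lam n h).rowLen 0 = n - lam.card := by
  refine eq_of_forall_lt_iff fun j => ?_
  rw [← YoungDiagram.mem_iff_lt_rowLen, mem_paddedDiagram_zero]

/-- The diagram without its first row. -/
def YoungDiagram.tail (mu : YoungDiagram) : YoungDiagram where
  cells := (mu.cells.filter fun x => x.1 ≠ 0).image fun x => (x.1 - 1, x.2)
  isLowerSet := by
    rintro ⟨i, j⟩ ⟨i', j'⟩ ⟨hi, hj⟩ hx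
    simp only [Finset.coe_image, Finset.coe_filter, Set.mem_image, Set.mem_ofPred_eq, Prod.mk.injEq,
      Prod.exists, YoungDiagram.mem_cells] at hx ⊢
    simp only at hi hj
    obtain ⟨a, b, ⟨hab, ha⟩, h1, h2⟩ := hx
    exact ⟨i' + 1, j', ⟨mu.up_left_mem (by omega) (by omega) hab, by omega⟩, rfl, rfl⟩

theorem YoungDiagram.mem_tail {mu : YoungDiagram} {i j : ℕ} :
    (i, j) ∈ mu.tail ↔ (i + 1, j) ∈ mu := by
  rw [← YoungDiagram.mem_cells, YoungDiagram.tail]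
  simp only [Finset.mem_image, Finset.mem_filter, Prod.mk.injEq, Prod.exists,
    YoungDiagram.mem_cells]
  constructor
  · rintro ⟨a, b, ⟨hab, ha⟩, rfl, rfl⟩
    rwa [Nat.sub_add_cancel (Nat.pos_of_ne_zero ha)]
  · exact fun h => ⟨i + 1, j, ⟨h, by omega⟩, rfl, rfl⟩

theorem YoungDiagram.card_tail (mu : YoungDiagram) : mu.tail.card + mu.rowLen 0 = mu.card := by
  have h : mu.tail.card = (mu.cells.filter fun x => x.1 ≠ 0).card := by
    refine Finset.card_image_of_injOn ?_
    rintro ⟨a, b⟩ h1 ⟨c, d⟩ h2 h3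
    simp at h1 h2 h3
    ext <;> simp <;> omega
  rw [h, YoungDiagram.rowLen_eq_card, add_comm]
  exact Finset.card_filter_add_card_filter_not fun x : ℕ × ℕ => x.1 = 0

theorem YoungDiagram.rowLen_tail_le (mu : YoungDiagram) : mu.tail.rowLen 0 ≤ mu.rowLen 0 := by
  refine le_of_forall_lt fun j hj => ?_
  rw [← YoungDiagram.mem_iff_lt_rowLen, YoungDiagram.mem_tail] at hj
  exact YoungDiagram.mem_iff_lt_rowLen.1 (mu.up_left_mem (Nat.zero_le _) le_rfl hj)

theorem paddedDiagram_tail {mu : YoungDiagram} {n : ℕ} (hn : mu.card = n)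
    (h : mu.tail.card + mu.tail.rowLen 0 ≤ n) : paddedDiagram mu.tail n h = mu := by
  have hcard := mu.card_tail
  refine YoungDiagram.ext (Finset.ext ?_)
  rintro ⟨_ | i, j⟩
  · rw [YoungDiagram.mem_cells, YoungDiagram.mem_cells, mem_paddedDiagram_zero,
      YoungDiagram.mem_iff_lt_rowLen]
    omega
  · rw [YoungDiagram.mem_cells, YoungDiagram.mem_cells, mem_paddedDiagram_succ,
      YoungDiagram.mem_tail]

theorem IsConstituent.card_eq {n : ℕ} {E : Type*} [AddCommGroup E] [Module ℂ E]
    {mu : YoungDiagram} {ρ : Representation ℂ (Equiv.Perm (Fin n)) E} (h : IsConstituent mu ρ) :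
    mu.card = n := by
  obtain ⟨T, -⟩ := h
  have := Fintype.card_congr T
  rw [Fintype.card_fin, Fintype.card_coe] at this
  exact this.symm

namespace FIModule

variable {V : FIModule.{u}}

/-- Every diagram with `n` boxes is its tail padded to size `n`, and the first row of `λ[n]` has `n
- |λ|` boxes. So weight at most `M` excludes first rows shorter than `n - M`. For `n ≤ M` the
truncated difference is `0` and nothing is excluded. -/
theorem hasWeightLE_iff {M : ℕ} :
    V.HasWeightLE M ↔ ∀ n v, symKilled (V.rep n) (n - M) v → v = 0 := by
  constructor
  · intro H n v hv
    by_contra h0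
    obtain ⟨mu, hmu, hc⟩ := exists_symKilled_iff.1 ⟨v, h0, hv⟩
    have h1 := mu.card_tail
    have h2 := mu.rowLen_tail_le
    have h3 := hc.card_eq
    have h4 : mu.tail.card + mu.tail.rowLen 0 ≤ n := by omega
    have h5 := H n mu.tail h4 (by rwa [paddedDiagram_tail h3 h4])
    omega
  · intro H n lam h hc
    by_contra! hlt
    obtain ⟨v, h0, hv⟩ := exists_symKilled_iff.2 ⟨_, lt_of_eq_of_lt (rowLen_paddedDiagram h)
      (by omega : n - lam.card < n - M), hc⟩
    exact h0 (H n v hv)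

/-- The permutations of `[n+1]` that move only points of the shifted set `K` fix `0`, so they are
the extensions of those that move only points of `K`. -/
theorem asAlgebraHom_symmetrizer_shift {n : ℕ} (K : Finset (Fin n)) (v : V.at' (n + 1)) :
    (V.shift.rep n).asAlgebraHom (symmetrizer (collapse K)) v =
      (V.rep (n + 1)).asAlgebraHom (symmetrizer (collapse (K.map (Fin.succEmb n)))) v := by
  classical
  refine (asAlgebraHom_symmetrizer_apply (V.shift.rep n) _ v).trans ?_
  rw [asAlgebraHom_symmetrizer_apply]
  have hmem : ∀ i : Fin n, i.succ ∈ K.map (Fin.succEmb n) ↔ i ∈ K := fun i =>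
    Finset.mem_map' (Fin.succEmb n)
  have h0 : (0 : Fin (n + 1)) ∉ K.map (Fin.succEmb n) := by
    intro h
    obtain ⟨i, -, hi⟩ := Finset.mem_map.1 h
    exact Fin.succ_ne_zero i hi
  refine Finset.sum_bij (fun σ _ => extendPerm σ) (fun σ hσ => ?_)
    (fun σ _ τ _ h => extendPerm_injective n h) (fun τ hτ => ?_) fun σ _ => ?_
  · refine Finset.mem_filter.2 ⟨Finset.mem_univ _, fun k => collapse_eq_iff.2 ?_⟩
    induction k using Fin.cases with
    | zero => exact Or.inl rfl
    | succ k =>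
      refine (collapse_eq_iff.1 ((Finset.mem_filter.1 hσ).2 k)).imp (congrArg Fin.succ) ?_
      exact And.imp (hmem _).2 (hmem _).2
  · have h := (Finset.mem_filter.1 hτ).2
    obtain ⟨σ, rfl⟩ := exists_extendPerm_eq
      ((collapse_eq_iff.1 (h 0)).resolve_right fun h => h0 h.2)
    refine ⟨σ, Finset.mem_filter.2 ⟨Finset.mem_univ _, fun k => collapse_eq_iff.2 ?_⟩, rfl⟩
    exact (collapse_eq_iff.1 (h k.succ)).imp (fun h => Fin.succ_injective _ h)
      (And.imp (hmem _).1 (hmem _).1)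
  · rfl

/-- Since `(n+1) - (M+1) = n - M`, the subset size is the same for `V_{n+1}` and for the shift in
degree `n`, and the shift tests only the subsets that avoid `0`. In degree `0` the only subset is
empty and its symmetrizer is `1`. -/
theorem HasWeightLE.of_shift {M : ℕ} (h : V.shift.HasWeightLE M) : V.HasWeightLE (M + 1) := by
  rw [hasWeightLE_iff] at h ⊢
  rintro (_ | n) v hv
  · rw [Nat.zero_sub] at hv
    exact symKilled_zero hv
  · refine h n v fun K hK => ?_
    rw [asAlgebraHom_symmetrizer_shift]
    exact hv _ (by rw [Finset.card_map, hK]; omega)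

/-- Here the subsets of `[n+1]` have one element more than those tested in the shift. Removing `0`,
if present, leaves room for a subset `L` of size `n - M`, and the symmetrizer of `K` kills whatever
that of `L ⊆ K` kills. -/
theorem HasWeightLE.shift {M : ℕ} (h : V.HasWeightLE M) : V.shift.HasWeightLE M := by
  rw [hasWeightLE_iff] at h ⊢
  intro n v hv
  rcases lt_or_ge n M with hn | hn
  · rw [Nat.sub_eq_zero_of_le hn.le] at hv
    exact symKilled_zero hv
  · refine h (n + 1) v fun K hK => ?_
    have hle : n - M ≤ (K.erase 0).card := by
      have := Finset.pred_card_le_card_erase (s := K) (a := 0)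
      omega
    obtain ⟨L, hL, hLcard⟩ := Finset.exists_subset_card_eq hle
    obtain ⟨L, rfl⟩ : ∃ L' : Finset (Fin n), L'.map (Fin.succEmb n) = L := by
      refine ⟨L.preimage Fin.succ (Fin.succ_injective n).injOn, ?_⟩
      rw [Finset.map_eq_image]
      refine (Finset.image_preimage _ _ _).trans (Finset.filter_true_of_mem fun i hi => ?_)
      exact Fin.exists_succ_eq.2 (Finset.ne_of_mem_erase (hL hi))
    refine asAlgebraHom_symmetrizer_eq_zero_of_subset (hL.trans (Finset.erase_subset _ _)) ?_
    exact (asAlgebraHom_symmetrizer_shift L v).symm.trans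
      (hv L (by rwa [Finset.card_map] at hLcard))

end FIModule

/-! ### The main theorem -/

theorem mainTheorem4 (V : FIModule.{u}) :
    -- degree of generation, for finitely generated modules
    (∀ d : ℕ, V.FinitelyGenerated → V.GeneratedInDegreeLE d →
      V.shift.FinitelyGeneratedInDegreeLE d) ∧
    (∀ d : ℕ, Module.Finite ℂ (V.at' 0) → V.shift.FinitelyGeneratedInDegreeLE d →
      V.FinitelyGeneratedInDegreeLE (d + 1)) ∧
    -- degree of generation, for arbitrary modules
    (∀ d : ℕ, V.GeneratedInDegreeLE d → V.shift.GeneratedInDegreeLE d) ∧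
    (∀ d : ℕ, V.shift.GeneratedInDegreeLE d → V.GeneratedInDegreeLE (d + 1)) ∧
    -- weight
    (∀ M : ℕ, V.shift.HasWeightLE M → V.HasWeightLE (M + 1)) ∧
    (∀ M : ℕ, V.HasWeightLE M → V.shift.HasWeightLE M) ∧
    -- stability degree
    (∀ N : ℕ, V.shift.HasStabilityDegreeLE N → V.HasStabilityDegreeLE (N + 1)) ∧
    (∀ N : ℕ, V.HasStabilityDegreeLE N → V.shift.HasStabilityDegreeLE N) := by
  exact ⟨fun d h hd => (h.finitelyGeneratedInDegreeLE hd).shift, fun d _ h => h.of_shift,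
    fun d h => h.shift, fun d h => h.of_shift, fun M h => h.of_shift, fun M h => h.shift,
    fun N h => h.of_shift, fun N h => h.shift⟩
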